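/- Let $q\in\mathbb C$, $q\neq 0,1$, fix $\ln q=\ln|q|+i\arg q$ with $0\le\arg q<2\pi$, and put $q^{a}=e^{a\ln q}$. A generalized formal power series is a series $\varphi=\sum_{j\ge 0}c_jz^{\lambda_j}$ with $c_j,\lambda_j\in\mathbb C$, $c_0\ne0$, pairwise distinct $\lambda_j$, $\operatorname{Re}\lambda_j\le\operatorname{Re}\lambda_{j+1}$ and $\operatorname{Re}\lambda_j\to+\infty$; put $\sigma\varphi=\sum_j c_jq^{\lambda_j}z^{\lambda_j}$. Let $F(z,y_0,\dots,y_n)$ be a polynomial and let $\varphi$ be a formal solution of $F(z,y,\sigma y,\dots,\sigma^ny)=0$ such that $$\frac{\partial F}{\partial y_k}(z,\varphi,\sigma\varphi,\dots,\sigma^n\varphi)=A_kz^{\kappa}+(\text{terms with exponents of real part}>\operatorname{Re}\kappa),\qquad k=0,\dots,n,$$ with the same $\kappa$, $\operatorname{Re}\kappa\ge0$, for all $k$, and with at least one $A_k\neq0$. Put $L(\xi)=A_n\xi^n+\dots+A_1\xi+A_0$. Let $j_0\ge0$ and let $\alpha_1,\dots,\alpha_s\in\mathbb C$ have positive real parts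 and generate an additive semigroup $\Gamma=\{m_1\alpha_1+\dots+m_s\alpha_s:\ m_i\in\mathbb Z_{\ge0}\}$ with $\lambda_j-\lambda_{j_0}\in\Gamma$ for all $j>j_0$ with $c_j\ne0$. Let $\mathcal L$ be the line through $0$ with slope $\ln|q|/\arg q$. We say that $a\in\mathbb C$ lies strictly above, on, or strictly under $\mathcal L$ if $\operatorname{Im}a\cdot\arg q$ is, respectively, $>$, $=$, or $<\operatorname{Re}a\cdot\ln|q|$, that is, if $|q^{a}|<1$, $=1$, or $>1$ (this is also the meaning when $\arg q=0$). For $a\ne0$ consider the diophantine condition $$(\ast)\qquad \Bigl|\bigl(\lambda_{j_0}+\textstyle\sum_i m_i\alpha_i\bigr)\ln q-\ln a-2\pi m\,i\Bigr|>c\,(m_1+\dots+m_s)^{-\nu}\quad\text{for all }(m_1,\dots,m_s)\in\mathbb Z_{\ge0}^s\setminus\{0\},\ m\in\mathbb Z,$$ with some constants $c,\nu>0$. In cases (c), (d), (e) below, $j_0$ and the generators are supposed to be adapted to the equation in the following sense: with $\lambda=\lambda_{j_0}$ and $\varphi_0=\sum_{j\le j_0}c_jz^{\lambda_j}$, the substitution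 $y=\varphi_0+z^{\lambda}u$ turns the left-hand side of the equation into $z^{\lambda+\kappa}$ times a polynomial in $u,\sigma u,\dots,\sigma^nu$ whose coefficients are finite linear combinations of powers $z^\gamma$ with $\gamma\in\Gamma$. Then, in each of the following cases, $\varphi$ has a non-zero radius of convergence: in every sector with vertex $0$, of opening less than $2\pi$ and of sufficiently small radius, and for every branch of $\log z$ there, the series $\sum_j c_jz^{\lambda_j}$ converges uniformly and its sum is holomorphic (the radius can be chosen the same for all sectors and branches for which the argument of the bisecting ray stays in a bounded interval). (a) $L(0)\neq0$ and all $\alpha_i$ lie strictly above $\mathcal L$. (b) $\deg L=n$ and all $\alpha_i$ lie strictly under $\mathcal L$. (c) All $\alpha_i$ lie on $\mathcal L$, and $(\ast)$ holds for every root $a$ of $(\xi-q^{\lambda_{j_0}})L(\xi)$ with $|a|=|q^{\lambda_{j_0}}|$. (d) $L(0)\ne0$, all $\alpha_i$ lie above or on $\mathcal L$, and $(\ast)$ holds for every root $a$ of $(\xi-q^{\lambda_{j_0}})L(\xi)$ with $|a|\le|q^{\lambda_{j_0}}|$. (e) $\deg L=n$, all $\alpha_i$ lie under or on $\mathcal L$,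 and $(\ast)$ holds for every root $a$ of $(\xi-q^{\lambda_{j_0}})L(\xi)$ with $|a|\ge|q^{\lambda_{j_0}}|$. -/

import Mathlib

open Filter

noncomputable section

/-- Exponents `a ∈ ℂ` of formal monomials `z ^ a`, ordered lexicographically by `(Re a, Im a)`.
The order only serves to form the ring of Hahn series. -/
def expo (a : ℂ) : ℝ ×ₗ ℝ := toLex (a.re, a.im)

/-- The complex number that an exponent stands for; inverse to `expo`. -/
def expoVal (g : ℝ ×ₗ ℝ) : ℂ := ⟨(ofLex g).1, (ofLex g).2⟩

theorem expoVal_expo (a : ℂ) : expoVal (expo a) = a := rfl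

theorem expo_expoVal (g : ℝ ×ₗ ℝ) : expo (expoVal g) = g := rfl

/-- The commutative ring of Hahn series with complex exponents: it contains all generalized
formal power series, with the usual (convolution) product. -/
abbrev FormalSeries : Type := HahnSeries (ℝ ×ₗ ℝ) ℂ

/-- The formal monomial `c z ^ a`. -/
def mono (a c : ℂ) : FormalSeries := HahnSeries.single (expo a) c

/-- The value of `arg q` in `[0, 2π)`. -/
def argQ (q : ℂ) : ℝ := toIcoMod Real.two_pi_pos 0 q.arg

/-- The value of `ln q` with `0 ≤ arg q < 2π`. -/
def lnQ (q : ℂ) : ℂ := (Real.log ‖q‖ : ℂ) + (argQ q : ℂ) * Complex.I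

/-- `q ^ a = exp (a ln q)` with the fixed value of `ln q`. -/
def qPow (q a : ℂ) : ℂ := Complex.exp (a * lnQ q)

/-- The dilatation operator `σ`, sending `∑ c z ^ a` to `∑ c q ^ a z ^ a`. -/
def dil (q : ℂ) (x : FormalSeries) : FormalSeries where
  coeff g := qPow q (expoVal g) * x.coeff g
  isPWO_support' := x.isPWO_support.mono fun _ hg => right_ne_zero_of_mul hg

/-- A generalized formal power series `∑_{j ≥ 0} c_j z ^ {lam_j}`, with pairwise distinct exponents
whose real parts are nondecreasing and tend to `+∞`, and with `c_0 ≠ 0`. -/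
structure GenPowerSeries where
  lam : ℕ → ℂ
  c : ℕ → ℂ
  lam_injective : Function.Injective lam
  c_zero_ne : c 0 ≠ 0
  re_monotone : Monotone fun j => (lam j).re
  re_tendsto : Tendsto (fun j => (lam j).re) atTop atTop

theorem GenPowerSeries.isPWO_range (φ : GenPowerSeries) :
    (Set.range fun j => expo (φ.lam j)).IsPWO := by
  rw [Set.isPWO_iff_isWF, Set.isWF_iff_no_descending_seq]
  intro f hf hmem
  have hsub : Set.range f ⊆
      (fun j => expo (φ.lam j)) '' {j | (φ.lam j).re ≤ (ofLex (f 0)).1} := by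
    rintro _ ⟨k, rfl⟩
    obtain ⟨j, hj⟩ := hmem k
    refine ⟨j, ?_, hj⟩
    have h1 : f k ≤ f 0 := hf.antitone (Nat.zero_le k)
    have h2 : (ofLex (f k)).1 ≤ (ofLex (f 0)).1 := by
      rcases Prod.Lex.le_iff.mp h1 with h | h
      · exact h.le
      · exact h.1.le
    rw [← hj] at h2
    exact h2
  have hfin : {j | (φ.lam j).re ≤ (ofLex (f 0)).1}.Finite := by
    obtain ⟨N, hN⟩ := (φ.re_tendsto.eventually_gt_atTop (ofLex (f 0)).1).exists_forall_of_atTop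
    refine (Set.finite_lt_nat N).subset fun j hj => ?_
    by_contra h
    exact absurd (hN j (not_lt.mp h)) (not_lt.mpr hj)
  exact Set.infinite_range_of_injective hf.injective ((hfin.image _).subset hsub)

/-- The series as an element of the ring of Hahn series: the coefficient of `z ^ {lam_j}` is `c_j`,
every other coefficient is `0`. -/
def GenPowerSeries.series (φ : GenPowerSeries) : FormalSeries where
  coeff := Function.extend (fun j => expo (φ.lam j)) φ.c 0
  isPWO_support' := φ.isPWO_range.mono fun g hg => by
    by_contra h
    exact hg (Function.extend_apply' _ _ _ h)

/-- The finite initial part `∑_{j ≤ j₀} c_j z ^ {lam_j}`. -/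
def GenPowerSeries.initial (φ : GenPowerSeries) (j₀ : ℕ) : FormalSeries :=
  ∑ j ∈ Finset.range (j₀ + 1), mono (φ.lam j) (φ.c j)

/-- For a polynomial `F` in `z` (the variable `none`) and `y_0, …, y_n` (the variables `some k`),
the series `F(z, x, σ x, …, σ ^ n x)`. -/
def substSeries {n : ℕ} (q : ℂ) (F : MvPolynomial (Option (Fin (n + 1))) ℂ) (x : FormalSeries) :
    FormalSeries :=
  MvPolynomial.aeval
    (fun v => v.elim (mono 1 1) fun k : Fin (n + 1) => (dil q)^[(k : ℕ)] x) F

/-- The series `∂F/∂y_k (z, φ, σ φ, …, σ ^ n φ)`. -/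
def derivSeries {n : ℕ} (q : ℂ) (F : MvPolynomial (Option (Fin (n + 1))) ℂ) (φ : GenPowerSeries)
    (k : Fin (n + 1)) : FormalSeries :=
  substSeries q (MvPolynomial.pderiv (some k) F) φ.series

/-- Each `∂F/∂y_k (z, φ, σ φ, …, σ ^ n φ)` is of the form `A_k z ^ κ +` (terms whose exponents have
real part `> Re κ`), with the same `κ`, `Re κ ≥ 0`, for all `k`, and some `A_k ≠ 0`. -/
def HasLeadingExponent {n : ℕ} (q : ℂ) (F : MvPolynomial (Option (Fin (n + 1))) ℂ)
    (φ : GenPowerSeries) (κ : ℂ) : Prop :=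
  0 ≤ κ.re ∧
  (∀ k : Fin (n + 1), ∀ b : ℂ, (derivSeries q F φ k).coeff (expo b) ≠ 0 → b = κ ∨ κ.re < b.re) ∧
  ∃ k : Fin (n + 1), (derivSeries q F φ k).coeff (expo κ) ≠ 0

/-- The polynomial `L(ξ) = A_n ξ ^ n + … + A_1 ξ + A_0`, where `A_k` is the coefficient of `z ^ κ`
in `∂F/∂y_k (z, φ, σ φ, …, σ ^ n φ)`. -/
def leadPoly {n : ℕ} (q : ℂ) (F : MvPolynomial (Option (Fin (n + 1))) ℂ) (φ : GenPowerSeries)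
    (κ : ℂ) : Polynomial ℂ :=
  ∑ k : Fin (n + 1), Polynomial.C ((derivSeries q F φ k).coeff (expo κ)) * Polynomial.X ^ (k : ℕ)

/-- The result of the substitution `y = φ₀ + z ^ λ u`, where `φ₀ = ∑_{j ≤ j₀} c_j z ^ {lam_j}` and
`λ = lam_{j₀}`, in `F(z, y, σ y, …, σ ^ n y)`, as a polynomial in `u_k = σ ^ k u`:
`F(z, φ₀ + z ^ λ u_0, …, σ ^ n φ₀ + q ^ {n λ} z ^ λ u_n)`. -/
def shiftedPoly {n : ℕ} (q : ℂ) (F : MvPolynomial (Option (Fin (n + 1))) ℂ) (φ : GenPowerSeries)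
    (j₀ : ℕ) : MvPolynomial (Fin (n + 1)) FormalSeries :=
  MvPolynomial.aeval
    (fun v => v.elim (MvPolynomial.C (mono 1 1)) fun k : Fin (n + 1) =>
      MvPolynomial.C ((dil q)^[(k : ℕ)] (φ.initial j₀)) +
      MvPolynomial.C ((dil q)^[(k : ℕ)] (mono (φ.lam j₀) 1)) * MvPolynomial.X k) F

/-- The additive semigroup (with `0`) generated by `α_1, …, α_s`. -/
def genSemigroup {s : ℕ} (α : Fin s → ℂ) : AddSubmonoid ℂ := AddSubmonoid.closure (Set.range α)

/-- After the substitution `y = φ₀ + z ^ λ u` and division by `z ^ (λ + κ)`, the equation becomes a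
polynomial equation in `u, σ u, …, σ ^ n u` whose coefficients only involve powers `z ^ γ` with
`γ` in the semigroup generated by `α_1, …, α_s`. -/
def ReducedExponentsIn {n s : ℕ} (q : ℂ) (F : MvPolynomial (Option (Fin (n + 1))) ℂ)
    (φ : GenPowerSeries) (κ : ℂ) (j₀ : ℕ) (α : Fin s → ℂ) : Prop :=
  ∀ (p : Fin (n + 1) →₀ ℕ) (b : ℂ),
    ((shiftedPoly q F φ j₀).coeff p).coeff (expo b) ≠ 0 → b - (φ.lam j₀ + κ) ∈ genSemigroup α

/-- The diophantine condition for a number `a`, with positive constants `C` and `ν`. -/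
def Diophantine {s : ℕ} (q lam : ℂ) (α : Fin s → ℂ) (a : ℂ) : Prop :=
  ∃ C ν : ℝ, 0 < C ∧ 0 < ν ∧ ∀ m : Fin s → ℕ, m ≠ 0 → ∀ k : ℤ,
    C * ((∑ i, m i : ℕ) : ℝ) ^ (-ν) <
      ‖(lam + ∑ i, (m i : ℂ) * α i) * lnQ q - Complex.log a
        - 2 * (Real.pi : ℂ) * (k : ℂ) * Complex.I‖

/-- `a` lies strictly above the line through `0` with slope `ln |q| / arg q`
(when `arg q = 0` this means `Re a * ln |q| < 0`). In all cases it means `|q ^ a| < 1`. -/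
def StrictlyAbove (q a : ℂ) : Prop := a.re * Real.log ‖q‖ < a.im * argQ q

/-- `a` lies strictly under the line through `0` with slope `ln |q| / arg q`. -/
def StrictlyUnder (q a : ℂ) : Prop := a.im * argQ q < a.re * Real.log ‖q‖

/-- `a` lies on the line through `0` with slope `ln |q| / arg q`. -/
def OnLine (q a : ℂ) : Prop := a.im * argQ q = a.re * Real.log ‖q‖

/-- The branch of `log z` whose imaginary part lies in `(θ - π, θ + π]`. -/
def logBranch (θ : ℝ) (z : ℂ) : ℂ :=
  Complex.log (z * Complex.exp (-(θ * Complex.I))) + θ * Complex.I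

/-- The open sector with vertex `0`, radius `r`, bisecting direction `θ` and opening `2 δ`. -/
def sector (θ δ r : ℝ) : Set ℂ :=
  {z | z ≠ 0 ∧ ‖z‖ < r ∧ |(z * Complex.exp (-(θ * Complex.I))).arg| < δ}

/-- The series has a non-zero radius of convergence: in every sector of opening less than `2 π` and
of sufficiently small radius, for every choice of the branch of the logarithm, it converges
uniformly to a holomorphic function. The radius is the same for all sectors and branches
for which the argument of the bisecting ray stays in a given bounded interval. -/
def GenPowerSeries.Converges (φ : GenPowerSeries) : Prop :=
  ∀ B : ℝ, ∃ r : ℝ, 0 < r ∧ ∀ θ δ : ℝ, |θ| ≤ B → 0 < δ → δ < Real.pi →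
    ∃ f : ℂ → ℂ, DifferentiableOn ℂ f (sector θ δ r) ∧
      HasSumUniformlyOn (fun j z => φ.c j * Complex.exp (φ.lam j * logBranch θ z)) f
        (sector θ δ r)

end

/-!
The series `φ` is split as `φ = φ₀ + z ^ μ u`, with `φ₀` a finite initial part, and `u` solves a reduced
equation `L(q ^ μ σ) u + Q(z, u, σ u, …, σ ^ n u) = 0`, in which `Q` collects the terms of order at least
two in `u` and the terms carrying a positive power of `z`. All exponents lie in a submonoid `G` of
`ℂ` whose nonzero elements have real part at least some `δ > 0`. Comparing coefficients expresses
`L(q ^ {μ + g}) u_g` through coefficients of `u` at exponents of real part at most `Re g - δ`.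

Everything is estimated in weighted `ℓ¹` norms `∑ w(g) |u_g|` with values in `[0, ∞]`, which are
submultiplicative as soon as the weight is. With `w(g) = exp (-h g) r ^ {Re g}`, truncated at `Re g ≤ N`,
the norm `U N` satisfies `U (N + δ) ≤ M (r ^ δ + (U N) ^ 2)` while `U N ≤ 1`, so for small `r` it stays
below a fixed bound for all `N` (`exists_wnorm_lt_top`). This needs the divisors to be absorbed by
`h`: the quotient `max (1, |q ^ g|) ^ n / |L(q ^ {μ + g})|` has to be at most `C exp (b g)` with
`h g + h g' + b (g + g') ≤ h (g + g')` and `h g ≤ H Re g`. The factor `max (1, |q ^ g|) ^ n` accounts for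
the operators `σ ^ k` in the nonlinear terms.

In cases (a) and (b) the quotient is bounded along the exponents of `φ`, because `q ^ {lam_j}` tends to
`0` or to `∞`; then `h = b = 0` is enough, `μ` is a large real number and `G` consists of `0` and the
exponents of real part at least `δ` (`exists_summable_of_divisor_bound`).

In cases (c), (d), (e) one takes `μ = lam_{j₀}` and for `G` the given semigroup. The polynomial `L` is
factored over its roots `a`, and the quotient is a product of factors `1 / |q ^ {μ + g} - a|`, each
either bounded or subject to the Diophantine inequality. If two nested exponents `x` and `x + y` both
make `|q ^ {μ + g} - a|` smaller than `exp (-j)` up to a constant, then `|q ^ y - 1|` is of the same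
order, and the Diophantine inequality for `q ^ μ` forces `Re y ≥ c exp (t j)`. Small divisors of size
`exp (-j)` are therefore sparse in any decomposition of an exponent `g` into a sum over a tree: at most
`2 Re g / (c exp (t j))` nodes carry one. The function `pot` is an explicit potential that realizes this
count (`pot_add_le`), and `h` is the sum of these potentials over `j` (`Controlled.of_sparse`).

Finally, absolute convergence of `∑ |c_j| ρ ^ {Re lam_j}` gives uniform convergence in sectors, as
`|Im lam_j|` is bounded linearly in `Re lam_j` (`converges_of_summable`).
-/

namespace QDiff

open scoped ENNReal

/-! ### Exponents, characters and the dilatation operator -/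

/-- The real part of an exponent. -/
noncomputable def reE : ℝ ×ₗ ℝ →+ ℝ where
  toFun g := (ofLex g).1
  map_zero' := rfl
  map_add' _ _ := rfl

theorem expo_add (a b : ℂ) : expo (a + b) = expo a + expo b := rfl

theorem expo_neg (a : ℂ) : expo (-a) = -expo a := rfl

theorem expo_sub (a b : ℂ) : expo (a - b) = expo a - expo b := rfl

theorem expo_zero : expo 0 = 0 := rfl

theorem expoVal_add (g h : ℝ ×ₗ ℝ) : expoVal (g + h) = expoVal g + expoVal h := rfl

theorem expoVal_zero : expoVal 0 = 0 := rfl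

theorem expo_injective : Function.Injective expo :=
  Function.LeftInverse.injective expoVal_expo

theorem reE_expo (a : ℂ) : reE (expo a) = a.re := rfl

theorem re_expoVal (g : ℝ ×ₗ ℝ) : (expoVal g).re = reE g := rfl

theorem reE_mono {g h : ℝ ×ₗ ℝ} (H : g ≤ h) : reE g ≤ reE h := by
  rcases Prod.Lex.le_iff.mp H with h | h
  · exact h.le
  · exact h.1.le

/-- The map `expoVal` as an additive homomorphism. -/
noncomputable def expoValHom : ℝ ×ₗ ℝ →+ ℂ where
  toFun := expoVal
  map_zero' := rfl
  map_add' _ _ := rfl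

theorem qPow_add (q a b : ℂ) : qPow q (a + b) = qPow q a * qPow q b := by
  simp [qPow, add_mul, Complex.exp_add]

theorem qPow_zero (q : ℂ) : qPow q 0 = 1 := by simp [qPow]

theorem qPow_ne_zero (q a : ℂ) : qPow q a ≠ 0 := Complex.exp_ne_zero _

/-- The factor `q ^ g` by which `σ` multiplies the monomial of exponent `g`. -/
noncomputable def chi (q : ℂ) (g : ℝ ×ₗ ℝ) : ℂ := qPow q (expoVal g)

theorem chi_add (q : ℂ) (g h : ℝ ×ₗ ℝ) : chi q (g + h) = chi q g * chi q h := by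
  simp [chi, expoVal_add, qPow_add]

theorem chi_zero (q : ℂ) : chi q 0 = 1 := by simp [chi, expoVal_zero, qPow_zero]

theorem chi_expo (q a : ℂ) : chi q (expo a) = qPow q a := rfl

theorem dil_coeff (q : ℂ) (x : FormalSeries) (g : ℝ ×ₗ ℝ) :
    (dil q x).coeff g = chi q g * x.coeff g := rfl

theorem dil_mul (q : ℂ) (x y : FormalSeries) : dil q (x * y) = dil q x * dil q y := by
  ext g
  have hx : (dil q x).support ⊆ x.support := fun g hg => right_ne_zero_of_mul hg
  have hy : (dil q y).support ⊆ y.support := fun g hg => right_ne_zero_of_mul hg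
  rw [dil_coeff, HahnSeries.coeff_mul, HahnSeries.coeff_mul_left' x.isPWO_support hx,
    Finset.mul_sum]
  have : Finset.antidiagonal x.isPWO_support (dil q y).isPWO_support g ⊆
      Finset.antidiagonal x.isPWO_support y.isPWO_support g :=
    Finset.antidiagonal_mono_right hy
  rw [Finset.sum_subset this]
  · refine Finset.sum_congr rfl fun p hp => ?_
    rw [Finset.mem_antidiagonal] at hp
    rw [← hp.2.2, chi_add, dil_coeff, dil_coeff]
    ring
  · intro p hp hp'
    have : (dil q y).coeff p.2 = 0 := by
      by_contra h
      rw [Finset.mem_antidiagonal] at hp hp'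
      exact hp' ⟨hp.1, h, hp.2.2⟩
    rw [this, mul_zero]

theorem dil_single (q : ℂ) (g : ℝ ×ₗ ℝ) (c : ℂ) :
    dil q (HahnSeries.single g c) = HahnSeries.single g (chi q g * c) := by
  ext h
  rw [dil_coeff]
  by_cases H : h = g
  · subst H; simp
  · simp [HahnSeries.coeff_single_of_ne H]

/-- The dilatation operator as a ring homomorphism. -/
noncomputable def dilHom (q : ℂ) : FormalSeries →+* FormalSeries where
  toFun := dil q
  map_one' := by
    change dil q (HahnSeries.single 0 1) = HahnSeries.single 0 1
    rw [dil_single, chi_zero, mul_one]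
  map_zero' := by ext g; simp [dil_coeff]
  map_add' x y := by ext g; simp [dil_coeff, mul_add]
  map_mul' := dil_mul q

/-- The power `σ ^ k` as a ring homomorphism. -/
noncomputable def dilPow (q : ℂ) (k : ℕ) : FormalSeries →+* FormalSeries := (dilHom q) ^ k

theorem iterate_dil (q : ℂ) (k : ℕ) (x : FormalSeries) : (dil q)^[k] x = dilPow q k x := by
  induction k generalizing x with
  | zero => rfl
  | succ k ih => rw [Function.iterate_succ_apply, ih, dilPow, dilPow, pow_succ]; rfl

theorem dilPow_coeff (q : ℂ) (k : ℕ) (x : FormalSeries) (g : ℝ ×ₗ ℝ) :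
    (dilPow q k x).coeff g = chi q g ^ k * x.coeff g := by
  induction k generalizing x with
  | zero => simp [dilPow]
  | succ k ih =>
    have : dilPow q (k + 1) x = dilPow q k (dil q x) := by rw [dilPow, dilPow, pow_succ]; rfl
    rw [this, ih, dil_coeff]; ring

theorem dilPow_single (q : ℂ) (k : ℕ) (g : ℝ ×ₗ ℝ) (c : ℂ) :
    dilPow q k (HahnSeries.single g c) = HahnSeries.single g (chi q g ^ k * c) := by
  ext h
  rw [dilPow_coeff]
  by_cases H : h = g
  · subst H; simp
  · simp [HahnSeries.coeff_single_of_ne H]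

/-! ### Weighted `ℓ¹` norms of Hahn series -/

/-- The weighted `ℓ¹` norm `∑ w(g) |x_g|`, with values in `[0, ∞]`. -/
noncomputable def wnorm (w : ℝ ×ₗ ℝ → ℝ≥0∞) (x : FormalSeries) : ℝ≥0∞ := ∑' g, w g * ‖x.coeff g‖ₑ

/-- The support of the series is contained in the set `S`. -/
noncomputable def SuppIn (S : Set (ℝ ×ₗ ℝ)) (x : FormalSeries) : Prop := ∀ g, x.coeff g ≠ 0 → g ∈ S

theorem wnorm_le_wnorm {w w' : ℝ ×ₗ ℝ → ℝ≥0∞} {x : FormalSeries} {S : Set (ℝ ×ₗ ℝ)}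
    (hx : SuppIn S x) (h : ∀ g ∈ S, w g ≤ w' g) : wnorm w x ≤ wnorm w' x := by
  refine ENNReal.tsum_le_tsum fun g => ?_
  by_cases hg : x.coeff g = 0
  · simp [hg]
  · gcongr; exact h g (hx g hg)

theorem wnorm_zero (w : ℝ ×ₗ ℝ → ℝ≥0∞) : wnorm w 0 = 0 := by simp [wnorm]

theorem wnorm_add_le (w : ℝ ×ₗ ℝ → ℝ≥0∞) (x y : FormalSeries) :
    wnorm w (x + y) ≤ wnorm w x + wnorm w y := by
  rw [wnorm, wnorm, wnorm, ← ENNReal.tsum_add]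
  refine ENNReal.tsum_le_tsum fun g => ?_
  rw [← mul_add]
  gcongr
  exact enorm_add_le _ _

theorem wnorm_sum_le {ι : Type*} (w : ℝ ×ₗ ℝ → ℝ≥0∞) (s : Finset ι) (f : ι → FormalSeries) :
    wnorm w (∑ i ∈ s, f i) ≤ ∑ i ∈ s, wnorm w (f i) := by
  classical
  induction s using Finset.induction_on with
  | empty => simp [wnorm_zero]
  | insert a s ha ih =>
    rw [Finset.sum_insert ha, Finset.sum_insert ha]
    exact (wnorm_add_le _ _ _).trans (by gcongr)

/-- The weighted norm of a product, for weights that are submultiplicative along the supports. -/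
theorem wnorm_mul_le {w w₁ w₂ : ℝ ×ₗ ℝ → ℝ≥0∞} {x y : FormalSeries} {S T : Set (ℝ ×ₗ ℝ)}
    (hx : SuppIn S x) (hy : SuppIn T y)
    (h : ∀ g ∈ S, ∀ g' ∈ T, w (g + g') ≤ w₁ g * w₂ g') :
    wnorm w (x * y) ≤ wnorm w₁ x * wnorm w₂ y := by
  let f : (ℝ ×ₗ ℝ) × (ℝ ×ₗ ℝ) → ℝ≥0∞ :=
    fun p => (w₁ p.1 * ‖x.coeff p.1‖ₑ) * (w₂ p.2 * ‖y.coeff p.2‖ₑ)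
  have hprod : wnorm w₁ x * wnorm w₂ y = ∑' p, f p := by
    rw [wnorm, wnorm, ENNReal.tsum_prod']
    simp only [f, ENNReal.tsum_mul_left, ENNReal.tsum_mul_right]
  have hfib : ∑' p, f p =
      ∑' g, ∑' p : {p : (ℝ ×ₗ ℝ) × (ℝ ×ₗ ℝ) // p.1 + p.2 = g}, f p := by
    rw [← (Equiv.sigmaFiberEquiv fun p : (ℝ ×ₗ ℝ) × (ℝ ×ₗ ℝ) => p.1 + p.2).tsum_eq f,
      ENNReal.tsum_sigma']
    rfl
  rw [hprod, hfib]
  refine ENNReal.tsum_le_tsum fun g => ?_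
  rw [HahnSeries.coeff_mul]
  set A := Finset.antidiagonal x.isPWO_support y.isPWO_support g with hA
  have hmem : ∀ p ∈ A, x.coeff p.1 ≠ 0 ∧ y.coeff p.2 ≠ 0 ∧ p.1 + p.2 = g := fun p hp => by
    rw [hA, Finset.mem_antidiagonal] at hp; exact hp
  calc w g * ‖∑ p ∈ A, x.coeff p.1 * y.coeff p.2‖ₑ
      ≤ w g * ∑ p ∈ A, ‖x.coeff p.1 * y.coeff p.2‖ₑ := by gcongr; exact enorm_sum_le _ _
    _ = ∑ p ∈ A, w g * ‖x.coeff p.1 * y.coeff p.2‖ₑ := Finset.mul_sum _ _ _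
    _ ≤ ∑ p ∈ A, f p := by
        refine Finset.sum_le_sum fun p hp => ?_
        obtain ⟨h1, h2, h3⟩ := hmem p hp
        rw [enorm_mul, ← h3]
        calc _ ≤ (w₁ p.1 * w₂ p.2) * (‖x.coeff p.1‖ₑ * ‖y.coeff p.2‖ₑ) := by
              gcongr; exact h _ (hx _ h1) _ (hy _ h2)
          _ = f p := by simp only [f]; ring
    _ = ∑ p ∈ A.attach, f p := (Finset.sum_attach A f).symm
    _ = ∑ p ∈ A.attach.map ⟨fun p => (⟨p.1, (hmem p.1 p.2).2.2⟩ :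
          {p : (ℝ ×ₗ ℝ) × (ℝ ×ₗ ℝ) // p.1 + p.2 = g}),
          fun a b hab => Subtype.ext (by injection hab)⟩, f p := by
        rw [Finset.sum_map]; rfl
    _ ≤ _ := ENNReal.sum_le_tsum _

theorem suppIn_mul {S T U : Set (ℝ ×ₗ ℝ)} {x y : FormalSeries} (hx : SuppIn S x)
    (hy : SuppIn T y) (h : ∀ g ∈ S, ∀ g' ∈ T, g + g' ∈ U) : SuppIn U (x * y) := by
  intro g hg
  obtain ⟨a, ha, b, hb, rfl⟩ := HahnSeries.support_mul_subset (HahnSeries.mem_support _ _ |>.2 hg)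
  exact h a (hx a ha) b (hy b hb)

theorem suppIn_add {S : Set (ℝ ×ₗ ℝ)} {x y : FormalSeries} (hx : SuppIn S x)
    (hy : SuppIn S y) : SuppIn S (x + y) := by
  intro g hg
  by_cases h : x.coeff g = 0
  · exact hy g fun h' => hg (by simp [h, h'])
  · exact hx g h

theorem suppIn_neg {S : Set (ℝ ×ₗ ℝ)} {x : FormalSeries} (hx : SuppIn S x) : SuppIn S (-x) :=
  fun g hg => hx g fun h => hg (by simp [h])

theorem suppIn_single {S : Set (ℝ ×ₗ ℝ)} {g : ℝ ×ₗ ℝ} (hg : g ∈ S) (c : ℂ) :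
    SuppIn S (HahnSeries.single g c) := by
  intro g' h
  by_cases H : g' = g
  · rwa [H]
  · exact absurd (HahnSeries.coeff_single_of_ne H) h

theorem suppIn_dilPow {S : Set (ℝ ×ₗ ℝ)} {x : FormalSeries} (q : ℂ) (k : ℕ) (hx : SuppIn S x) :
    SuppIn S (dilPow q k x) := by
  intro g hg
  rw [dilPow_coeff] at hg
  exact hx g (right_ne_zero_of_mul hg)

/-! ### The majorant argument -/

/-- The nonzero elements of a submonoid of exponents. -/
def posPart (G : AddSubmonoid (ℝ ×ₗ ℝ)) : Set (ℝ ×ₗ ℝ) := {g | g ∈ G ∧ g ≠ 0}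

/-- The truncated weight `exp (-f g) r ^ {Re g}` for `Re g ≤ N`, and `0` beyond. -/
noncomputable def truncWeight (f : ℝ ×ₗ ℝ → ℝ) (r N : ℝ) (g : ℝ ×ₗ ℝ) : ℝ≥0∞ :=
  if reE g ≤ N then ENNReal.ofReal (Real.exp (-f g) * r ^ reE g) else 0

theorem truncWeight_mul {f f₁ f₂ : ℝ ×ₗ ℝ → ℝ} {r N N₁ N₂ : ℝ} (hr : 0 < r) {g g' : ℝ ×ₗ ℝ}
    (hf : f₁ g + f₂ g' ≤ f (g + g')) (h₁ : reE (g + g') ≤ N → reE g ≤ N₁)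
    (h₂ : reE (g + g') ≤ N → reE g' ≤ N₂) :
    truncWeight f r N (g + g') ≤ truncWeight f₁ r N₁ g * truncWeight f₂ r N₂ g' := by
  by_cases h : reE (g + g') ≤ N
  · rw [truncWeight, truncWeight, truncWeight, if_pos h, if_pos (h₁ h), if_pos (h₂ h),
      ← ENNReal.ofReal_mul (by positivity)]
    apply ENNReal.ofReal_le_ofReal
    have : Real.exp (-f₁ g) * r ^ reE g * (Real.exp (-f₂ g') * r ^ reE g') =
        Real.exp (-f₁ g + -f₂ g') * r ^ reE (g + g') := by
      rw [Real.exp_add, map_add, Real.rpow_add hr]; ring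
    rw [this]
    gcongr
    linarith
  · rw [truncWeight, if_neg h]; exact zero_le

theorem truncWeight_le {f : ℝ ×ₗ ℝ → ℝ} {r N t : ℝ} (hr : 0 < r) (hr1 : r ≤ 1) {g : ℝ ×ₗ ℝ}
    (hf : 0 ≤ f g) (ht : t ≤ reE g) : truncWeight f r N g ≤ ENNReal.ofReal (r ^ t) := by
  rw [truncWeight]
  split_ifs
  · apply ENNReal.ofReal_le_ofReal
    calc Real.exp (-f g) * r ^ reE g ≤ 1 * r ^ t :=
          mul_le_mul (Real.exp_le_one_iff.2 (by linarith))
            (Real.rpow_le_rpow_of_exponent_ge hr hr1 ht) (by positivity) zero_le_one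
      _ = r ^ t := one_mul _
  · exact zero_le

theorem wnorm_const_mul_le {w w' : ℝ ×ₗ ℝ → ℝ≥0∞} {a : ℝ≥0∞} {x : FormalSeries}
    {S : Set (ℝ ×ₗ ℝ)} (hx : SuppIn S x) (h : ∀ g ∈ S, w g ≤ a * w' g) :
    wnorm w x ≤ a * wnorm w' x := by
  rw [wnorm, wnorm, ← ENNReal.tsum_mul_left]
  refine ENNReal.tsum_le_tsum fun g => ?_
  by_cases hg : x.coeff g = 0
  · simp [hg]
  · rw [← mul_assoc]; gcongr; exact h g (hx g hg)

theorem wnorm_lt_top_of_finite {w : ℝ ×ₗ ℝ → ℝ≥0∞} (hw : ∀ g, w g ≠ ∞) {x : FormalSeries}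
    (hx : x.support.Finite) : wnorm w x ≠ ∞ := by
  rw [wnorm, tsum_eq_sum (s := hx.toFinset)]
  · exact ENNReal.sum_ne_top.2 fun g _ => ENNReal.mul_ne_top (hw g) enorm_ne_top
  · intro g hg
    have : x.coeff g = 0 := by simpa using hg
    simp [this]

theorem suppIn_posPart {G : AddSubmonoid (ℝ ×ₗ ℝ)} {x : FormalSeries}
    (hx : SuppIn (G : Set (ℝ ×ₗ ℝ)) x) (h0 : x.coeff 0 = 0) : SuppIn (posPart G) x :=
  fun g hg => ⟨hx g hg, fun h => hg (h ▸ h0)⟩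

theorem SuppIn.mono {S T : Set (ℝ ×ₗ ℝ)} {x : FormalSeries} (hx : SuppIn S x) (h : S ⊆ T) :
    SuppIn T x := fun g hg => h (hx g hg)

theorem posPart_subset (G : AddSubmonoid (ℝ ×ₗ ℝ)) : posPart G ⊆ (G : Set (ℝ ×ₗ ℝ)) :=
  fun _ h => h.1

theorem reE_nonneg_of_gap {G : AddSubmonoid (ℝ ×ₗ ℝ)} {δ : ℝ} (hδ : 0 < δ)
    (hG : ∀ g ∈ posPart G, δ ≤ reE g) {g : ℝ ×ₗ ℝ} (hg : g ∈ G) : 0 ≤ reE g := by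
  by_cases h : g = 0
  · simp [h]
  · exact hδ.le.trans (hG g ⟨hg, h⟩)

theorem add_mem_posPart {G : AddSubmonoid (ℝ ×ₗ ℝ)} {δ : ℝ} (hδ : 0 < δ)
    (hG : ∀ g ∈ posPart G, δ ≤ reE g) {g g' : ℝ ×ₗ ℝ} (hg : g ∈ G) (hg' : g' ∈ posPart G) :
    g + g' ∈ posPart G := by
  refine ⟨G.add_mem hg hg'.1, fun h => ?_⟩
  have h1 := reE_nonneg_of_gap hδ hG hg
  have h2 := hG g' hg'
  have h3 : reE g + reE g' = 0 := by rw [← map_add, h, map_zero]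
  linarith

theorem exists_eq_single_add {ι : Type*} {d : ι →₀ ℕ} (hd : d ≠ 0) :
    ∃ (k : ι) (d' : ι →₀ ℕ), d = Finsupp.single k 1 + d' := by
  obtain ⟨k, hk⟩ : ∃ k, d k ≠ 0 := by
    by_contra! h
    exact hd (Finsupp.ext h)
  exact ⟨k, d - Finsupp.single k 1, (add_tsub_cancel_of_le
    (Finsupp.single_le_iff.2 (Nat.one_le_iff_ne_zero.2 hk))).symm⟩

theorem prod_pow_single_add {ι R : Type*} [Fintype ι] [CommMonoid R] (v : ι → R) (k : ι)
    (d : ι →₀ ℕ) : ∏ i, v i ^ (Finsupp.single k 1 + d : ι →₀ ℕ) i = v k * ∏ i, v i ^ d i := by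
  classical
  simp only [Finsupp.add_apply, pow_add, Finset.prod_mul_distrib]
  congr 1
  rw [Finset.prod_eq_single k]
  · simp
  · intro b _ hb; simp [Finsupp.single_eq_of_ne hb]
  · simp

/-- Products of series supported in `G` with norms at most `B`. -/
theorem wnorm_prod_pow_le {ι : Type*} [Fintype ι] {S : AddSubmonoid (ℝ ×ₗ ℝ)}
    {w : ℝ ×ₗ ℝ → ℝ≥0∞} (hw0 : w 0 ≤ 1)
    (hw : ∀ g ∈ S, ∀ g' ∈ S, w (g + g') ≤ w g * w g') {v : ι → FormalSeries} {B : ℝ≥0∞}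
    (hv : ∀ i, SuppIn (S : Set (ℝ ×ₗ ℝ)) (v i)) (hB : ∀ i, wnorm w (v i) ≤ B) (d : ι →₀ ℕ) :
    SuppIn (S : Set (ℝ ×ₗ ℝ)) (∏ i, v i ^ d i) ∧ wnorm w (∏ i, v i ^ d i) ≤ B ^ d.degree := by
  classical
  induction hm : d.degree generalizing d with
  | zero =>
    obtain rfl : d = 0 := (Finsupp.degree_eq_zero_iff d).1 hm
    simp only [Finsupp.coe_zero, Pi.zero_apply, pow_zero, Finset.prod_const_one]
    refine ⟨suppIn_single S.zero_mem 1, ?_⟩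
    rw [wnorm, tsum_eq_single 0]
    · simpa using hw0
    · intro g hg; simp [HahnSeries.coeff_one, hg]
  | succ m ih =>
    obtain ⟨k, d', rfl⟩ := exists_eq_single_add (d := d) (by rintro rfl; simp at hm)
    have hm' : d'.degree = m := by
      simp only [map_add, Finsupp.degree_single] at hm; omega
    obtain ⟨h1, h2⟩ := ih d' hm'
    rw [prod_pow_single_add]
    refine ⟨suppIn_mul (hv k) h1 fun g hg g' hg' => S.add_mem hg hg', ?_⟩
    rw [pow_succ']
    exact (wnorm_mul_le (hv k) h1 hw).trans (mul_le_mul' (hB k) h2)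

/-- One step of the majorant argument: the norm of `Q(u, σ u, …)` up to height `N + δ`, with the
larger weight `exp (b - h)`, is controlled by the norms of the `σ ^ k u` up to height `N`. -/
theorem wnorm_eval_le {ι : Type*} [Fintype ι] {G : AddSubmonoid (ℝ ×ₗ ℝ)} {δ : ℝ} (hδ : 0 < δ)
    (hG : ∀ g ∈ posPart G, δ ≤ reE g) {Q : MvPolynomial ι FormalSeries}
    (hQ : ∀ p, SuppIn (G : Set (ℝ ×ₗ ℝ)) (Q.coeff p))
    (hQ1 : ∀ p, p.degree ≤ 1 → (Q.coeff p).coeff 0 = 0)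
    {h b : ℝ ×ₗ ℝ → ℝ} (h0 : h 0 = 0) (hb : ∀ g ∈ posPart G, 0 ≤ b g ∧ b g ≤ h g)
    (hadd : ∀ g ∈ posPart G, ∀ g' ∈ posPart G, h g + h g' + b (g + g') ≤ h (g + g'))
    {r : ℝ} (hr : 0 < r) (hr1 : r ≤ 1) {N : ℝ} {v : ι → FormalSeries}
    (hv : ∀ i, SuppIn (posPart G) (v i)) {B : ℝ≥0∞} (hB1 : B ≤ 1)
    (hB : ∀ i, wnorm (truncWeight h r N) (v i) ≤ B) :
    wnorm (truncWeight (fun g => h g - b g) r (N + δ)) (MvPolynomial.eval v Q) ≤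
      (∑ p ∈ Q.support, wnorm (fun _ => 1) (Q.coeff p)) * (ENNReal.ofReal (r ^ δ) + B ^ 2) := by
  have hre : ∀ g ∈ G, 0 ≤ reE g := fun g hg => reE_nonneg_of_gap hδ hG hg
  have hhpos : ∀ g ∈ G, 0 ≤ h g := fun g hg => by
    by_cases hg0 : g = 0
    · simp [hg0, h0]
    · exact (hb g ⟨hg, hg0⟩).1.trans (hb g ⟨hg, hg0⟩).2
  have hsup : ∀ g ∈ G, ∀ g' ∈ G, h g + h g' ≤ h (g + g') := by
    intro g hg g' hg'
    by_cases hg0 : g = 0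
    · simp [hg0, h0]
    by_cases hg0' : g' = 0
    · simp [hg0', h0]
    have h1 := hadd g ⟨hg, hg0⟩ g' ⟨hg', hg0'⟩
    have h2 := (hb _ (add_mem_posPart hδ hG hg ⟨hg', hg0'⟩)).1
    linarith
  have hw : ∀ g ∈ G, ∀ g' ∈ G,
      truncWeight h r N (g + g') ≤ truncWeight h r N g * truncWeight h r N g' := by
    intro g hg g' hg'
    refine truncWeight_mul hr (hsup g hg g' hg') (fun H => ?_) fun H => ?_
    · rw [map_add] at H; linarith [hre g' hg']
    · rw [map_add] at H; linarith [hre g hg]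
  have hw0 : truncWeight h r N 0 ≤ 1 := by
    have := truncWeight_le (f := h) (N := N) (t := 0) hr hr1 (g := 0) (by simp [h0]) (by simp)
    simpa using this
  have hwv : ∀ g ∈ posPart G, ∀ g' ∈ posPart G,
      truncWeight (fun g => h g - b g) r (N + δ) (g + g') ≤
        truncWeight h r N g * truncWeight h r N g' := by
    intro g hg g' hg'
    refine truncWeight_mul hr (by have := hadd g hg g' hg'; linarith)
      (fun H => ?_) fun H => ?_
    · rw [map_add] at H; linarith [hG g' hg']
    · rw [map_add] at H; linarith [hG g hg]
  have hvG : ∀ i, SuppIn (G : Set (ℝ ×ₗ ℝ)) (v i) := fun i => (hv i).mono (posPart_subset G)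
  rw [MvPolynomial.eval_eq', Finset.sum_mul]
  refine (wnorm_sum_le _ _ _).trans (Finset.sum_le_sum fun p _ => ?_)
  set K := wnorm (fun _ => 1) (Q.coeff p) with hK
  have hwc : ∀ f : ℝ ×ₗ ℝ → ℝ, (∀ g ∈ posPart G, 0 ≤ f g) → ∀ N', SuppIn (posPart G) (Q.coeff p) →
      wnorm (truncWeight f r N') (Q.coeff p) ≤ K * ENNReal.ofReal (r ^ δ) := by
    intro f hf N' hs
    rw [mul_comm]
    exact wnorm_const_mul_le hs fun g hg => by
      rw [mul_one]; exact truncWeight_le hr hr1 (hf g hg) (hG g hg)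
  by_cases hp0 : p = 0
  · subst hp0
    simp only [Finsupp.coe_zero, Pi.zero_apply, pow_zero, Finset.prod_const_one, mul_one]
    refine (hwc _ (fun g hg => sub_nonneg.2 (hb g hg).2) _
      (suppIn_posPart (hQ 0) (hQ1 0 (by simp)))).trans ?_
    gcongr
    exact le_self_add
  obtain ⟨k, d, rfl⟩ := exists_eq_single_add hp0
  rw [prod_pow_single_add]
  by_cases hd : d = 0
  · subst hd
    simp only [Finsupp.coe_zero, Pi.zero_apply, pow_zero, Finset.prod_const_one, mul_one]
    have hs := suppIn_posPart (hQ _) (hQ1 (Finsupp.single k 1 + 0) (by simp))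
    refine (wnorm_mul_le hs (hv k) hwv).trans ?_
    calc _ ≤ K * ENNReal.ofReal (r ^ δ) * 1 := by
          gcongr
          · exact hwc _ (fun g hg => hhpos g hg.1) _ hs
          · exact (hB k).trans hB1
      _ ≤ _ := by rw [mul_one]; gcongr; exact le_self_add
  · obtain ⟨hs1, hn1⟩ := wnorm_prod_pow_le hw0 hw hvG hB d
    obtain ⟨k', d', hd'⟩ := exists_eq_single_add hd
    have hs2 : SuppIn (posPart G) (∏ i, v i ^ d i) := by
      rw [hd', prod_pow_single_add, mul_comm]
      exact suppIn_mul (wnorm_prod_pow_le hw0 hw hvG hB d').1 (hv k')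
        fun g hg g' hg' => add_mem_posPart hδ hG hg hg'
    have hdeg : 1 ≤ d.degree := by rw [hd', map_add, Finsupp.degree_single]; omega
    have hs3 : SuppIn (posPart G) (Q.coeff (Finsupp.single k 1 + d) * ∏ i, v i ^ d i) :=
      suppIn_mul (hQ _) hs2 fun g hg g' hg' => add_mem_posPart hδ hG hg hg'
    rw [mul_left_comm]
    refine (wnorm_mul_le (hv k) hs3 hwv).trans ?_
    calc _ ≤ B * (K * B ^ d.degree) := by
          gcongr
          · exact hB k
          · refine (wnorm_mul_le (hQ _) hs1 hw).trans ?_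
            gcongr
            refine wnorm_le_wnorm (hQ _) fun g hg => ?_
            simpa using truncWeight_le (t := 0) (N := N) hr hr1 (hhpos g hg) (hre g hg)
      _ ≤ B * (K * B ^ 1) := by
          gcongr 2
          exact pow_le_pow_right_of_le_one' hB1 hdeg
      _ = K * B ^ 2 := by ring
      _ ≤ _ := by gcongr; exact le_add_self

/-- A solution `u` of `∑ ℓ_k σ ^ k u + Q(u, σ u, …, σ ^ n u) = 0`, whose exponents lie in a submonoid
`G` with a gap above `0`, converges absolutely as soon as the divisors `∑ ℓ_k q ^ {k g}` are
controlled by a cost function `b` that is absorbed by a superadditive potential `h` of at most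
linear growth. -/
theorem exists_wnorm_lt_top {n : ℕ} (q : ℂ) {G : AddSubmonoid (ℝ ×ₗ ℝ)} {δ : ℝ} (hδ : 0 < δ)
    (hG : ∀ g ∈ posPart G, δ ≤ reE g) (ℓ : Fin (n + 1) → ℂ)
    {Q : MvPolynomial (Fin (n + 1)) FormalSeries}
    (hQ : ∀ p, SuppIn (G : Set (ℝ ×ₗ ℝ)) (Q.coeff p)) (hQfin : ∀ p, (Q.coeff p).support.Finite)
    (hQ1 : ∀ p, p.degree ≤ 1 → (Q.coeff p).coeff 0 = 0)
    {u : FormalSeries} (hu : SuppIn (posPart G) u)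
    (heq : ∑ k : Fin (n + 1), HahnSeries.single 0 (ℓ k) * dilPow q k u +
      MvPolynomial.eval (fun k : Fin (n + 1) => dilPow q k u) Q = 0)
    {h b : ℝ ×ₗ ℝ → ℝ} (h0 : h 0 = 0) (hb : ∀ g ∈ posPart G, 0 ≤ b g ∧ b g ≤ h g)
    (hadd : ∀ g ∈ posPart G, ∀ g' ∈ posPart G, h g + h g' + b (g + g') ≤ h (g + g'))
    {C : ℝ} (hC0 : 0 ≤ C)
    (hC : ∀ g, u.coeff g ≠ 0 → max 1 ‖chi q g‖ ^ n ≤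
      C * Real.exp (b g) * ‖∑ k : Fin (n + 1), ℓ k * chi q g ^ (k : ℕ)‖)
    {H : ℝ} (hH : ∀ g ∈ posPart G, h g ≤ H * reE g) :
    ∃ ρ : ℝ, 0 < ρ ∧ wnorm (fun g => ENNReal.ofReal (ρ ^ reE g)) u < ∞ := by
  set W : ℝ ×ₗ ℝ → ℝ := fun g => max 1 ‖chi q g‖ ^ n with hW
  have hW1 : ∀ g, 1 ≤ W g := fun g => one_le_pow₀ (le_max_left _ _)
  set K : ℝ≥0∞ := ∑ p ∈ Q.support, wnorm (fun _ => 1) (Q.coeff p) with hK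
  have hKtop : K ≠ ∞ := ENNReal.sum_ne_top.2 fun p _ =>
    wnorm_lt_top_of_finite (fun _ => ENNReal.one_ne_top) (hQfin p)
  set M : ℝ := C * K.toReal with hM
  have hM0 : 0 ≤ M := by positivity
  have hMK : ENNReal.ofReal C * K = ENNReal.ofReal M := by
    rw [hM, ENNReal.ofReal_mul hC0, ENNReal.ofReal_toReal hKtop]
  -- `η` bounds the norm of `u`; `r` makes the terms of order at most one smaller than `η / 2`
  set η : ℝ := 1 / (2 * (M + 1)) with hη
  have hη0 : 0 < η := by positivity
  have hη1 : η ≤ 1 := by rw [hη, div_le_one (by positivity)]; linarith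
  have hηM : (M + 1) * η = 1 / 2 := by rw [hη]; field_simp
  set r : ℝ := (η ^ 2) ^ (1 / δ) with hr
  have hr0 : 0 < r := by positivity
  have hr1 : r ≤ 1 := Real.rpow_le_one (by positivity) (pow_le_one₀ hη0.le hη1) (by positivity)
  have hrδ : r ^ δ = η ^ 2 := by
    rw [hr, ← Real.rpow_mul (by positivity), one_div_mul_cancel hδ.ne', Real.rpow_one]
  have hsmall : M * (r ^ δ + η ^ 2) ≤ η := by
    rw [hrδ]
    nlinarith [mul_pos hη0 hη0]
  set U : ℝ → ℝ≥0∞ := fun N => wnorm (fun g => ENNReal.ofReal (W g) * truncWeight h r N g) u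
    with hU
  have hWk : ∀ (k : Fin (n + 1)) g, ‖chi q g ^ (k : ℕ)‖ ≤ W g := fun k g => by
    rw [norm_pow]
    calc ‖chi q g‖ ^ (k : ℕ) ≤ max 1 ‖chi q g‖ ^ (k : ℕ) := by gcongr; exact le_max_right _ _
      _ ≤ W g := pow_le_pow_right₀ (le_max_left _ _) (by omega)
  have hdil : ∀ N (k : Fin (n + 1)), wnorm (truncWeight h r N) (dilPow q k u) ≤ U N := by
    intro N k
    refine ENNReal.tsum_le_tsum fun g => ?_
    rw [dilPow_coeff, enorm_mul, mul_left_comm, ← mul_assoc]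
    refine mul_le_mul' (mul_le_mul' ?_ le_rfl) le_rfl
    rw [← ofReal_norm]
    exact ENNReal.ofReal_le_ofReal (hWk k g)
  have hstep : ∀ N, U N ≤ ENNReal.ofReal η → U (N + δ) ≤ ENNReal.ofReal η := by
    intro N hUN
    have h1 : U (N + δ) ≤ ENNReal.ofReal C *
        wnorm (truncWeight (fun g => h g - b g) r (N + δ))
          (MvPolynomial.eval (fun k : Fin (n + 1) => dilPow q k u) Q) := by
      simp only [hU, wnorm]
      rw [← ENNReal.tsum_mul_left]
      refine ENNReal.tsum_le_tsum fun g => ?_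
      by_cases hg : u.coeff g = 0
      · simp [hg]
      by_cases hgN : reE g ≤ N + δ
      swap
      · simp [truncWeight, hgN]
      have hcoef : (MvPolynomial.eval (fun k : Fin (n + 1) => dilPow q k u) Q).coeff g =
          -((∑ k : Fin (n + 1), ℓ k * chi q g ^ (k : ℕ)) * u.coeff g) := by
        have := congrArg (fun x : FormalSeries => x.coeff g) heq
        simp only [HahnSeries.coeff_add, HahnSeries.coeff_sum, HahnSeries.coeff_zero,
          HahnSeries.coeff_single_zero_mul, dilPow_coeff] at this
        rw [eq_neg_of_add_eq_zero_right this, Finset.sum_mul]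
        simp only [mul_assoc]
      rw [hcoef, enorm_neg, enorm_mul, truncWeight, truncWeight, if_pos hgN, if_pos hgN,
        ← ofReal_norm, ← ofReal_norm,
        ← ENNReal.ofReal_mul (by positivity), ← ENNReal.ofReal_mul (by positivity),
        ← ENNReal.ofReal_mul (by positivity), ← ENNReal.ofReal_mul (by positivity),
        ← ENNReal.ofReal_mul (by positivity)]
      apply ENNReal.ofReal_le_ofReal
      have hsplit : Real.exp (-(h g - b g)) = Real.exp (b g) * Real.exp (-h g) := by
        rw [← Real.exp_add]; ring_nf
      rw [hsplit]
      calc _ ≤ (C * Real.exp (b g) * ‖∑ k : Fin (n + 1), ℓ k * chi q g ^ (k : ℕ)‖) *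
            (Real.exp (-h g) * r ^ reE g) * ‖u.coeff g‖ := by gcongr; exact hC g hg
        _ = _ := by ring
    have h2 := wnorm_eval_le hδ hG hQ hQ1 h0 hb hadd hr0 hr1
      (fun k : Fin (n + 1) => suppIn_dilPow q k hu)
      (B := ENNReal.ofReal η) (by simpa using hη1) fun k => (hdil N k).trans hUN
    calc U (N + δ) ≤ ENNReal.ofReal C * (K * (ENNReal.ofReal (r ^ δ) + ENNReal.ofReal η ^ 2)) :=
          h1.trans (by gcongr)
      _ = ENNReal.ofReal (M * (r ^ δ + η ^ 2)) := by
          rw [← mul_assoc, hMK, ← ENNReal.ofReal_pow hη0.le,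
            ← ENNReal.ofReal_add (by positivity) (by positivity), ← ENNReal.ofReal_mul hM0]
      _ ≤ ENNReal.ofReal η := ENNReal.ofReal_le_ofReal hsmall
  have hall : ∀ m : ℕ, U (m * δ) ≤ ENNReal.ofReal η := by
    intro m
    induction m with
    | zero =>
      have : U ((0 : ℕ) * δ) = 0 := by
        rw [hU]
        refine ENNReal.tsum_eq_zero.2 fun g => ?_
        by_cases hg : u.coeff g = 0
        · simp [hg]
        · have := hG g (hu g hg)
          have hneg : ¬ reE g ≤ 0 := by linarith
          simp [truncWeight, hneg]
      rw [this]; exact zero_le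
    | succ m ih =>
      have := hstep (m * δ) ih
      rwa [show ((m + 1 : ℕ) : ℝ) * δ = m * δ + δ by push_cast; ring]
  refine ⟨r * Real.exp (-H), by positivity, lt_of_le_of_lt ?_ (ENNReal.ofReal_lt_top (r := η))⟩
  rw [wnorm, ENNReal.tsum_eq_iSup_sum]
  refine iSup_le fun s => ?_
  obtain ⟨N, hN⟩ : ∃ N : ℝ, ∀ g ∈ s, reE g ≤ N := by
    obtain ⟨N, hN⟩ := (s.image reE).bddAbove
    exact ⟨N, fun g hg => hN (Finset.mem_coe.2 (Finset.mem_image_of_mem _ hg))⟩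
  obtain ⟨m, hm⟩ := exists_nat_gt (N / δ)
  have hm' : N ≤ m * δ := ((div_lt_iff₀ hδ).1 hm).le
  refine le_trans ?_ (hall m)
  refine le_trans (Finset.sum_le_sum fun g hg => ?_) (ENNReal.sum_le_tsum s)
  by_cases hgu : u.coeff g = 0
  · simp [hgu]
  refine mul_le_mul' ?_ le_rfl
  simp only [truncWeight, if_pos ((hN g hg).trans hm')]
  rw [← ENNReal.ofReal_mul (by positivity)]
  apply ENNReal.ofReal_le_ofReal
  rw [Real.mul_rpow hr0.le (Real.exp_pos _).le, ← Real.exp_mul]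
  have h1 : Real.exp (-H * reE g) ≤ Real.exp (-h g) := by
    gcongr
    have := hH g (hu g hgu)
    linarith
  calc r ^ reE g * Real.exp (-H * reE g) ≤ r ^ reE g * Real.exp (-h g) := by gcongr
    _ = 1 * (Real.exp (-h g) * r ^ reE g) := by ring
    _ ≤ _ := by gcongr; exact hW1 g

/-! ### A potential for small divisors -/

section Potential

variable (G : AddSubmonoid (ℝ ×ₗ ℝ)) (Bad : Set (ℝ ×ₗ ℝ)) (s : ℝ)

/-- The values whose infimum is the potential of `x`: the bound `(2 Re x / s - 1)⁺` for an arbitrary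
exponent, and the bound `(2 Re (x + y) / s - 2)⁺` for an `x` lying below a bad exponent `x + y`. -/
def potSet (x : ℝ ×ₗ ℝ) : Set ℝ :=
  insert (max 0 (2 * reE x / s - 1))
    {t | ∃ y ∈ posPart G, x + y ∈ Bad ∧ t = max 0 (2 * reE (x + y) / s - 2)}

/-- A bound for the number of bad exponents met in any decomposition of `x`, when any two nested bad
exponents differ by at least `s`. -/
noncomputable def pot (x : ℝ ×ₗ ℝ) : ℝ := sInf (potSet G Bad s x)

variable {G Bad s}

theorem potSet_nonneg {x : ℝ ×ₗ ℝ} {t : ℝ} (ht : t ∈ potSet G Bad s x) : 0 ≤ t := by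
  rcases ht with rfl | ⟨y, -, -, rfl⟩ <;> exact le_max_left _ _

theorem pot_nonneg (x : ℝ ×ₗ ℝ) : 0 ≤ pot G Bad s x :=
  Real.sInf_nonneg fun _ ht => potSet_nonneg ht

theorem pot_le_of_mem {x : ℝ ×ₗ ℝ} {t : ℝ} (ht : t ∈ potSet G Bad s x) : pot G Bad s x ≤ t :=
  csInf_le ⟨0, fun _ h => potSet_nonneg h⟩ ht

theorem pot_le (x : ℝ ×ₗ ℝ) : pot G Bad s x ≤ max 0 (2 * reE x / s - 1) :=
  pot_le_of_mem (Set.mem_insert _ _)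

theorem pot_le_of_bad {x y : ℝ ×ₗ ℝ} (hy : y ∈ posPart G) (h : x + y ∈ Bad) :
    pot G Bad s x ≤ max 0 (2 * reE (x + y) / s - 2) :=
  pot_le_of_mem (Set.mem_insert_of_mem _ ⟨y, hy, h, rfl⟩)

theorem le_pot {x : ℝ ×ₗ ℝ} {t : ℝ} (h₁ : t ≤ max 0 (2 * reE x / s - 1))
    (h₂ : ∀ y ∈ posPart G, x + y ∈ Bad → t ≤ max 0 (2 * reE (x + y) / s - 2)) :
    t ≤ pot G Bad s x := by
  refine le_csInf ⟨_, Set.mem_insert _ _⟩ ?_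
  rintro t (rfl | ⟨y, hy, hb, rfl⟩)
  · exact h₁
  · exact h₂ y hy hb

open Classical in
theorem indicator_le_pot (hs : 0 < s)
    (hbad : ∀ x ∈ posPart G, x ∈ Bad → s ≤ reE x)
    (hgap : ∀ x ∈ posPart G, ∀ y ∈ posPart G, x ∈ Bad → x + y ∈ Bad → s ≤ reE y)
    {x : ℝ ×ₗ ℝ} (hx : x ∈ posPart G) : (if x ∈ Bad then 1 else 0) ≤ pot G Bad s x := by
  split_ifs with h
  · have h1 := (one_le_div hs).2 (hbad x hx h)
    refine le_pot (le_max_of_le_right ?_) fun y hy hxy => le_max_of_le_right ?_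
    · rw [mul_div_assoc]; linarith
    · have h2 := (one_le_div hs).2 (hgap x hx y hy h hxy)
      rw [map_add, mul_div_assoc, add_div]; linarith
  · exact pot_nonneg _

open Classical in
/-- The key property of the potential: it is superadditive, with a gain of one at bad exponents. If
both `pot x` and `pot y` are positive, the gain comes from the constants `-1`; if only `pot x` is,
and `x + y` is bad, it comes from the second bound in the definition of `pot x`. -/
theorem pot_add_le (hs : 0 < s) (hre : ∀ x ∈ posPart G, 0 < reE x)
    (hbad : ∀ x ∈ posPart G, x ∈ Bad → s ≤ reE x)
    (hgap : ∀ x ∈ posPart G, ∀ y ∈ posPart G, x ∈ Bad → x + y ∈ Bad → s ≤ reE y)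
    {x y : ℝ ×ₗ ℝ} (hx : x ∈ posPart G) (hy : y ∈ posPart G) (hxy : x + y ∈ posPart G) :
    pot G Bad s x + pot G Bad s y + (if x + y ∈ Bad then 1 else 0) ≤ pot G Bad s (x + y) := by
  have hx0 : 0 < reE x / s := div_pos (hre x hx) hs
  have hy0 : 0 < reE y / s := div_pos (hre y hy) hs
  have hHx := pot_le (G := G) (Bad := Bad) (s := s) x
  have hHy := pot_le (G := G) (Bad := Bad) (s := s) y
  have hpx := pot_nonneg (G := G) (Bad := Bad) (s := s) x
  have hpy := pot_nonneg (G := G) (Bad := Bad) (s := s) y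
  have hre2 : ∀ a b : ℝ ×ₗ ℝ, 2 * reE (a + b) / s = 2 * (reE a / s) + 2 * (reE b / s) := by
    intro a b; rw [map_add]; ring
  have hre1 : ∀ a : ℝ ×ₗ ℝ, 2 * reE a / s = 2 * (reE a / s) := fun a => by ring
  rw [hre1] at hHx hHy
  have hone : pot G Bad s x + pot G Bad s y + (if x + y ∈ Bad then 1 else 0) ≤
      max 0 (2 * reE (x + y) / s - 1) := by
    rw [hre2]
    split_ifs with h
    · have h1 := (one_le_div hs).2 (hbad _ hxy h)
      rw [map_add, add_div] at h1
      have hbx := pot_le_of_bad (s := s) hy h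
      have hby := pot_le_of_bad (s := s) hx (by rwa [add_comm] : y + x ∈ Bad)
      rw [hre2] at hbx hby
      grind
    · grind
  refine le_pot hone fun z hz hbz => ?_
  have hz0 : 0 < reE z / s := div_pos (hre z hz) hs
  by_cases h : x + y ∈ Bad
  · have h1 := (one_le_div hs).2 (hgap _ hxy z hz h hbz)
    rw [hre2] at hone
    rw [hre2, map_add, add_div]
    grind
  · have hyz : y + z ∈ posPart G :=
      ⟨G.add_mem hy.1 hz.1, fun h => by
        have : reE y + reE z = 0 := by rw [← map_add, h, map_zero]
        linarith [hre y hy, hre z hz]⟩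
    have hxz : x + z ∈ posPart G :=
      ⟨G.add_mem hx.1 hz.1, fun h => by
        have : reE x + reE z = 0 := by rw [← map_add, h, map_zero]
        linarith [hre x hx, hre z hz]⟩
    have hbx := pot_le_of_bad (s := s) hyz (by rwa [← add_assoc] : x + (y + z) ∈ Bad)
    have hby := pot_le_of_bad (s := s) hxz (by rwa [← add_assoc, add_comm y x] : y + (x + z) ∈ Bad)
    rw [if_neg h, add_zero]
    rw [hre2, map_add, add_div] at hbx hby ⊢
    grind

end Potential

/-! ### Controlled divisors -/

/-- The factors `D g`, `g ∈ G \ {0}`, are controlled: up to a constant they are at most `exp (b g)`,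
for a cost `b` absorbed by a superadditive potential `h` of at most linear growth. This makes the
product of the `D g` over all nodes of any decomposition tree of `g` exponentially bounded. -/
def Controlled (G : AddSubmonoid (ℝ ×ₗ ℝ)) (D : ℝ ×ₗ ℝ → ℝ) : Prop :=
  ∃ (C H : ℝ) (h b : ℝ ×ₗ ℝ → ℝ), 0 ≤ C ∧
    (∀ g ∈ posPart G, 0 ≤ b g ∧ b g ≤ h g ∧ h g ≤ H * reE g ∧ D g ≤ C * Real.exp (b g)) ∧
    ∀ g ∈ posPart G, ∀ g' ∈ posPart G, h g + h g' + b (g + g') ≤ h (g + g')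

theorem Controlled.const {G : AddSubmonoid (ℝ ×ₗ ℝ)} {D : ℝ ×ₗ ℝ → ℝ} {C : ℝ} (hC : 0 ≤ C)
    (h : ∀ g ∈ posPart G, D g ≤ C) : Controlled G D :=
  ⟨C, 0, 0, 0, hC, fun g hg => ⟨le_rfl, le_rfl, by simp, by simpa using h g hg⟩, by simp⟩

theorem Controlled.mul {G : AddSubmonoid (ℝ ×ₗ ℝ)} {D₁ D₂ : ℝ ×ₗ ℝ → ℝ}
    (h₁ : Controlled G D₁) (h₂ : Controlled G D₂) (hD₂ : ∀ g ∈ posPart G, 0 ≤ D₂ g) :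
    Controlled G (fun g => D₁ g * D₂ g) := by
  obtain ⟨C₁, H₁, p₁, b₁, hC₁, hb₁, ha₁⟩ := h₁
  obtain ⟨C₂, H₂, p₂, b₂, hC₂, hb₂, ha₂⟩ := h₂
  refine ⟨C₁ * C₂, H₁ + H₂, p₁ + p₂, b₁ + b₂, mul_nonneg hC₁ hC₂, fun g hg => ?_,
    fun g hg g' hg' => ?_⟩
  · obtain ⟨h1, h2, h3, h4⟩ := hb₁ g hg
    obtain ⟨k1, k2, k3, k4⟩ := hb₂ g hg
    simp only [Pi.add_apply]
    refine ⟨by linarith, by linarith, by linarith, ?_⟩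
    calc D₁ g * D₂ g ≤ (C₁ * Real.exp (b₁ g)) * (C₂ * Real.exp (b₂ g)) :=
          mul_le_mul h4 k4 (hD₂ g hg) (by positivity)
      _ = _ := by rw [Real.exp_add]; ring
  · have := ha₁ g hg g' hg'
    have := ha₂ g hg g' hg'
    simp only [Pi.add_apply]
    linarith

theorem Controlled.mono {G : AddSubmonoid (ℝ ×ₗ ℝ)} {D₁ D₂ : ℝ ×ₗ ℝ → ℝ}
    (h₁ : Controlled G D₁) {c : ℝ} (hc : 0 ≤ c) (h : ∀ g ∈ posPart G, D₂ g ≤ c * D₁ g) :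
    Controlled G D₂ := by
  obtain ⟨C₁, H₁, p₁, b₁, hC₁, hb₁, ha₁⟩ := h₁
  refine ⟨c * C₁, H₁, p₁, b₁, mul_nonneg hc hC₁, fun g hg => ?_, ha₁⟩
  obtain ⟨h1, h2, h3, h4⟩ := hb₁ g hg
  refine ⟨h1, h2, h3, (h g hg).trans ?_⟩
  rw [mul_assoc]
  gcongr

theorem Controlled.multiset_prod {ι : Type*} {G : AddSubmonoid (ℝ ×ₗ ℝ)} (S : Multiset ι)
    (D : ι → ℝ ×ₗ ℝ → ℝ) (hD : ∀ i ∈ S, Controlled G (D i))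
    (hpos : ∀ i ∈ S, ∀ g ∈ posPart G, 0 ≤ D i g) :
    Controlled G (fun g => (S.map fun i => D i g).prod) := by
  induction S using Multiset.induction_on with
  | empty => exact Controlled.const zero_le_one (by simp)
  | cons a S ih =>
    simp only [Multiset.map_cons, Multiset.prod_cons]
    refine (hD a (Multiset.mem_cons_self a S)).mul
      (ih (fun i hi => hD i (Multiset.mem_cons_of_mem hi))
        fun i hi => hpos i (Multiset.mem_cons_of_mem hi)) fun g hg => ?_
    refine Multiset.prod_nonneg fun x hx => ?_
    obtain ⟨i, hi, rfl⟩ := Multiset.mem_map.1 hx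
    exact hpos i (Multiset.mem_cons_of_mem hi) g hg

/-- A positive function is controlled if its large values are sparse: two nested exponents at which
`D > exp j` differ by at least `c exp (t j)`. The potential is the sum over `j` of the potentials of
the sets `{D > exp j}`. -/
theorem Controlled.of_sparse {G : AddSubmonoid (ℝ ×ₗ ℝ)} (hre : ∀ x ∈ posPart G, 0 < reE x)
    {D : ℝ ×ₗ ℝ → ℝ} {c t : ℝ} (hc : 0 < c) (ht : 0 < t)
    (hbad : ∀ j : ℕ, ∀ x ∈ posPart G, Real.exp j < D x → c * Real.exp (t * j) ≤ reE x)
    (hgap : ∀ j : ℕ, ∀ x ∈ posPart G, ∀ y ∈ posPart G, Real.exp j < D x →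
      Real.exp j < D (x + y) → c * Real.exp (t * j) ≤ reE y) :
    Controlled G D := by
  classical
  set s : ℕ → ℝ := fun j => c * Real.exp (t * j) with hs
  have hs0 : ∀ j, 0 < s j := fun j => by positivity
  set Bad : ℕ → Set (ℝ ×ₗ ℝ) := fun j => {x | Real.exp j < D x} with hBad
  have hadd : ∀ x ∈ posPart G, ∀ y ∈ posPart G, x + y ∈ posPart G := fun x hx y hy =>
    ⟨G.add_mem hx.1 hy.1, fun h => by
        have : reE x + reE y = 0 := by rw [← map_add, h, map_zero]
        linarith [hre x hx, hre y hy]⟩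
  have hsum : Summable fun j => 2 / s j := by
    have h1 : Summable fun j : ℕ => Real.exp (-t) ^ j :=
      summable_geometric_of_lt_one (Real.exp_pos _).le (by simpa using ht)
    refine (h1.mul_left (2 / c)).congr fun j => ?_
    rw [hs, ← Real.exp_nat_mul, mul_comm (j : ℝ), neg_mul, Real.exp_neg]
    simp only
    field_simp
  have hpot_le : ∀ x ∈ posPart G, ∀ j, pot G (Bad j) (s j) x ≤ 2 / s j * reE x := by
    intro x hx j
    have h1 : 0 < reE x / s j := div_pos (hre x hx) (hs0 j)
    refine (pot_le x).trans (max_le ?_ ?_)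
    · have := hre x hx; have := hs0 j; positivity
    · have : 2 / s j * reE x = 2 * reE x / s j := by ring
      linarith
  have hpsum : ∀ x ∈ posPart G, Summable fun j => pot G (Bad j) (s j) x := fun x hx =>
    Summable.of_nonneg_of_le (fun j => pot_nonneg _) (hpot_le x hx) (hsum.mul_right _)
  set ind : (ℝ ×ₗ ℝ) → ℕ → ℝ := fun x j => if x ∈ Bad j then 1 else 0 with hind
  have hind0 : ∀ x j, 0 ≤ ind x j := fun x j => by simp only [hind]; split_ifs <;> norm_num
  have hindle : ∀ x ∈ posPart G, ∀ j, ind x j ≤ pot G (Bad j) (s j) x := fun x hx j =>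
    indicator_le_pot (hs0 j) (hbad j) (hgap j) hx
  have hisum : ∀ x ∈ posPart G, Summable (ind x) := fun x hx =>
    Summable.of_nonneg_of_le (hind0 x) (hindle x hx) (hpsum x hx)
  refine ⟨1, ∑' j, 2 / s j, fun x => ∑' j, pot G (Bad j) (s j) x, fun x => ∑' j, ind x j,
    zero_le_one, fun g hg => ⟨tsum_nonneg (hind0 g), ?_, ?_, ?_⟩, fun g hg g' hg' => ?_⟩
  · exact (hisum g hg).tsum_le_tsum (hindle g hg) (hpsum g hg)
  · rw [← tsum_mul_right]
    exact (hpsum g hg).tsum_le_tsum (hpot_le g hg) (hsum.mul_right _)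
  · rw [one_mul]
    by_cases hD : D g ≤ 1
    · exact hD.trans (Real.one_le_exp (tsum_nonneg (hind0 g)))
    rw [not_le] at hD
    rw [← Real.log_le_iff_le_exp (by linarith)]
    have h1 : ∀ j ∈ Finset.range ⌈Real.log (D g)⌉₊, ind g j = 1 := by
      intro j hj
      have : (j : ℝ) < Real.log (D g) := Nat.lt_ceil.1 (Finset.mem_range.1 hj)
      have hmem : g ∈ Bad j := (Real.lt_log_iff_exp_lt (by linarith)).1 this
      simp [hind, hmem]
    calc Real.log (D g) ≤ ⌈Real.log (D g)⌉₊ := Nat.le_ceil _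
      _ = ∑ j ∈ Finset.range ⌈Real.log (D g)⌉₊, ind g j := by
          rw [Finset.sum_congr rfl h1]; simp
      _ ≤ _ := (hisum g hg).sum_le_tsum _ fun j _ => hind0 g j
  · have hsum1 := (hpsum g hg).add (hpsum g' hg')
    have hgg := hadd g hg g' hg'
    rw [← (hpsum g hg).tsum_add (hpsum g' hg'), ← hsum1.tsum_add (hisum _ hgg)]
    refine (hsum1.add (hisum _ hgg)).tsum_le_tsum (fun j => ?_) (hpsum _ hgg)
    exact pot_add_le (hs0 j) hre (hbad j) (hgap j) hg hg' hgg

/-! ### Bounds for divisors from Diophantine inequalities -/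

theorem rpow_le_of_le_exp {c K ν r : ℝ} (hc : 0 < c) (hK : 0 < K) (hν : 0 < ν) (hr : 0 < r) {j : ℕ}
    (h : c * r ^ (-ν) ≤ K * Real.exp (-(j : ℝ))) :
    (c / K) ^ ν⁻¹ * Real.exp (ν⁻¹ * j) ≤ r := by
  have h1 : c / K * Real.exp j ≤ r ^ ν := by
    rw [Real.rpow_neg hr.le, Real.exp_neg, ← div_eq_mul_inv, ← div_eq_mul_inv,
      div_le_div_iff₀ (by positivity) (by positivity)] at h
    rw [div_mul_eq_mul_div, div_le_iff₀ hK]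
    linarith
  calc (c / K) ^ ν⁻¹ * Real.exp (ν⁻¹ * j) = (c / K * Real.exp j) ^ ν⁻¹ := by
        rw [Real.mul_rpow (by positivity) (by positivity), ← Real.exp_mul, mul_comm ν⁻¹]
    _ ≤ (r ^ ν) ^ ν⁻¹ := by gcongr
    _ = r := Real.rpow_rpow_inv hr.le hν.ne'

theorem Controlled.add_const {G : AddSubmonoid (ℝ ×ₗ ℝ)} {D : ℝ ×ₗ ℝ → ℝ}
    (h : Controlled G D) {c : ℝ} (hc : 0 ≤ c) : Controlled G (fun g => c + D g) := by
  obtain ⟨C₁, H₁, p₁, b₁, hC₁, hb₁, ha₁⟩ := h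
  refine ⟨c + C₁, H₁, p₁, b₁, add_nonneg hc hC₁, fun g hg => ?_, ha₁⟩
  obtain ⟨h1, h2, h3, h4⟩ := hb₁ g hg
  refine ⟨h1, h2, h3, ?_⟩
  rw [add_mul]
  have := Real.one_le_exp h1
  nlinarith

/-- The reciprocal small divisors `1 / |q ^ {μ + g} - a|` are controlled: if two nested exponents `x`
and `x + y` both have a small divisor, then `|q ^ y - 1|` is small, which forces `Re y` to be
large. -/
theorem controlled_inv_norm_sub (q : ℂ) {G : AddSubmonoid (ℝ ×ₗ ℝ)}
    (hre : ∀ x ∈ posPart G, 0 < reE x) {m a : ℂ} (ha : a ≠ 0) {c ν c₁ ν₁ : ℝ} (hc : 0 < c)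
    (hν : 0 < ν) (hc₁ : 0 < c₁) (hν₁ : 0 < ν₁)
    (hdio : ∀ g ∈ posPart G, c * reE g ^ (-ν) ≤ ‖m * chi q g - a‖)
    (hdio₁ : ∀ g ∈ posPart G, c₁ * reE g ^ (-ν₁) ≤ ‖chi q g - 1‖) :
    Controlled G (fun g => ‖m * chi q g - a‖⁻¹) := by
  have ha0 : 0 < ‖a‖ := norm_pos_iff.2 ha
  set η : ℝ := ‖a‖ / 4 with hη
  have hη0 : 0 < η := by positivity
  set c' := min ((c / η) ^ ν⁻¹) ((c₁ / 1) ^ ν₁⁻¹) with hc'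
  have hc'0 : 0 < c' := lt_min (by positivity) (by positivity)
  set t := min ν⁻¹ ν₁⁻¹ with ht
  have ht0 : 0 < t := lt_min (by positivity) (by positivity)
  have hpos : ∀ g ∈ posPart G, 0 < ‖m * chi q g - a‖ := fun g hg =>
    lt_of_lt_of_le (mul_pos hc (Real.rpow_pos_of_pos (hre g hg) _)) (hdio g hg)
  have hsm : ∀ (j : ℕ) (g : ℝ ×ₗ ℝ), Real.exp j < η * ‖m * chi q g - a‖⁻¹ →
      ‖m * chi q g - a‖ < η * Real.exp (-(j : ℝ)) := by
    intro j g h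
    have h0 : 0 < ‖m * chi q g - a‖ := by
      by_contra h0
      rw [le_antisymm (not_lt.1 h0) (norm_nonneg _)] at h
      simp at h
      linarith [Real.exp_pos (j : ℝ)]
    rw [Real.exp_neg, ← div_eq_mul_inv, lt_div_iff₀ (Real.exp_pos _)]
    rw [← div_eq_mul_inv, lt_div_iff₀ h0] at h
    linarith
  have key : Controlled G (fun g => η * ‖m * chi q g - a‖⁻¹) := by
    refine Controlled.of_sparse hre hc'0 ht0 (fun j x hx h => ?_) fun j x hx y hy h1 h2 => ?_
    · refine le_trans ?_ (rpow_le_of_le_exp hc hη0 hν (hre x hx) ((hdio x hx).trans (hsm j x h).le))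
      gcongr
      · exact min_le_left _ _
      · exact min_le_left _ _
    · have h1' := hsm j x h1
      have h2' := hsm j (x + y) h2
      have hexp : Real.exp (-(j : ℝ)) ≤ 1 := by simp
      have hmx : ‖a‖ / 2 ≤ ‖m * chi q x‖ := by
        have h3 : ‖a‖ ≤ ‖m * chi q x‖ + ‖m * chi q x - a‖ := by
          calc ‖a‖ = ‖m * chi q x - (m * chi q x - a)‖ := by congr 1; ring
            _ ≤ _ := norm_sub_le _ _
        have h4 : η * Real.exp (-(j : ℝ)) ≤ η * 1 := by gcongr
        linarith
      have h5 : ‖m * chi q x‖ * ‖chi q y - 1‖ ≤ ‖a‖ / 2 * Real.exp (-(j : ℝ)) := by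
        rw [← norm_mul]
        calc ‖m * chi q x * (chi q y - 1)‖ = ‖(m * chi q (x + y) - a) - (m * chi q x - a)‖ := by
              rw [chi_add]; congr 1; ring
          _ ≤ ‖m * chi q (x + y) - a‖ + ‖m * chi q x - a‖ := norm_sub_le _ _
          _ ≤ η * Real.exp (-(j : ℝ)) + η * Real.exp (-(j : ℝ)) := by gcongr
          _ = _ := by rw [hη]; ring
      have h6 : ‖chi q y - 1‖ ≤ 1 * Real.exp (-(j : ℝ)) := by
        rw [one_mul]
        have h7 : ‖a‖ / 2 * ‖chi q y - 1‖ ≤ ‖a‖ / 2 * Real.exp (-(j : ℝ)) :=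
          le_trans (by gcongr) h5
        exact le_of_mul_le_mul_left h7 (by positivity)
      refine le_trans ?_ (rpow_le_of_le_exp hc₁ one_pos hν₁ (hre y hy) ((hdio₁ y hy).trans h6))
      gcongr
      · exact min_le_right _ _
      · exact min_le_right _ _
  refine key.mono (c := η⁻¹) (by positivity) fun g hg => ?_
  rw [← mul_assoc, inv_mul_cancel₀ hη0.ne', one_mul]

/-- The two ways in which a root `a` of `L` may be harmless: a Diophantine inequality holds, or
`q ^ {μ + g}` stays at a distance from `a` that is comparable with its size. -/
def RootCondition (q : ℂ) (G : AddSubmonoid (ℝ ×ₗ ℝ)) (m a : ℂ) : Prop :=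
  (a ≠ 0 ∧ ∃ c ν : ℝ, 0 < c ∧ 0 < ν ∧ ∀ g ∈ posPart G, c * reE g ^ (-ν) ≤ ‖m * chi q g - a‖) ∨
  ∃ ε : ℝ, 0 < ε ∧ ∀ g ∈ posPart G, ε * max 1 ‖chi q g‖ ≤ ‖m * chi q g - a‖

theorem RootCondition.pos {q : ℂ} {G : AddSubmonoid (ℝ ×ₗ ℝ)} {m a : ℂ}
    (h : RootCondition q G m a) (hre : ∀ x ∈ posPart G, 0 < reE x) {g : ℝ ×ₗ ℝ}
    (hg : g ∈ posPart G) : 0 < ‖m * chi q g - a‖ := by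
  rcases h with ⟨-, c, ν, hc, -, h⟩ | ⟨ε, hε, h⟩
  · exact lt_of_lt_of_le (mul_pos hc (Real.rpow_pos_of_pos (hre g hg) _)) (h g hg)
  · exact lt_of_lt_of_le (mul_pos hε (lt_max_of_lt_left one_pos)) (h g hg)

theorem RootCondition.controlled {q : ℂ} {G : AddSubmonoid (ℝ ×ₗ ℝ)} {m a : ℂ} (hm : m ≠ 0)
    (h : RootCondition q G m a) (hre : ∀ x ∈ posPart G, 0 < reE x) {c₁ ν₁ : ℝ} (hc₁ : 0 < c₁)
    (hν₁ : 0 < ν₁) (hdio₁ : ∀ g ∈ posPart G, c₁ * reE g ^ (-ν₁) ≤ ‖chi q g - 1‖) :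
    Controlled G (fun g => max 1 ‖chi q g‖ * ‖m * chi q g - a‖⁻¹) := by
  have hpos := fun g hg => h.pos hre (g := g) hg
  rcases h with ⟨ha, c, ν, hc, hν, h⟩ | ⟨ε, hε, h⟩
  · have hm0 : 0 < ‖m‖ := norm_pos_iff.2 hm
    refine ((controlled_inv_norm_sub q hre ha hc hν hc₁ hν₁ h hdio₁).add_const
      zero_le_one).mono (c := max 1 (‖a‖ / ‖m‖) + 1 / ‖m‖) (by positivity) fun g hg => ?_
    have h0 := hpos g hg
    set d := ‖m * chi q g - a‖ with hd
    have h1 : ‖m‖ * ‖chi q g‖ ≤ d + ‖a‖ := by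
      rw [← norm_mul, hd]
      calc ‖m * chi q g‖ = ‖(m * chi q g - a) + a‖ := by congr 1; ring
        _ ≤ _ := norm_add_le _ _
    have h2 : ‖chi q g‖ ≤ 1 / ‖m‖ * d + ‖a‖ / ‖m‖ := by
      rw [div_mul_eq_mul_div, ← add_div, le_div_iff₀ hm0]; linarith
    have h3 : max 1 ‖chi q g‖ ≤ 1 / ‖m‖ * d + max 1 (‖a‖ / ‖m‖) := by
      refine max_le ?_ (h2.trans (by gcongr; exact le_max_right _ _))
      have h4 : 0 ≤ 1 / ‖m‖ * d := by positivity
      linarith [le_max_left 1 (‖a‖ / ‖m‖)]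
    calc max 1 ‖chi q g‖ * d⁻¹ ≤ (1 / ‖m‖ * d + max 1 (‖a‖ / ‖m‖)) * d⁻¹ := by gcongr
      _ = 1 / ‖m‖ + max 1 (‖a‖ / ‖m‖) * d⁻¹ := by field_simp
      _ ≤ _ := by
        have h5 : 0 ≤ 1 / ‖m‖ * d⁻¹ := by positivity
        have h6 : 0 ≤ max 1 (‖a‖ / ‖m‖) := by positivity
        nlinarith
  · refine Controlled.const (C := ε⁻¹) (by positivity) fun g hg => ?_
    have h0 := hpos g hg
    rw [← div_eq_mul_inv, div_le_iff₀ h0, inv_mul_eq_div, le_div_iff₀ hε, mul_comm]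
    exact h g hg

/-- The divisors `L(q ^ {μ + g})`, compared with the growth of `q ^ {n g}`, are controlled if every
root of `L` is harmless. -/
theorem controlled_divisor {q : ℂ} {G : AddSubmonoid (ℝ ×ₗ ℝ)} {m : ℂ} (hm : m ≠ 0)
    (hre : ∀ x ∈ posPart G, 0 < reE x) {L : Polynomial ℂ} (hL : L ≠ 0) {n : ℕ}
    (hW : ∀ g ∈ posPart G, max 1 ‖chi q g‖ ^ n ≤ max 1 ‖chi q g‖ ^ L.roots.card)
    (hroot : ∀ a ∈ L.roots, RootCondition q G m a) {c₁ ν₁ : ℝ} (hc₁ : 0 < c₁)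
    (hν₁ : 0 < ν₁) (hdio₁ : ∀ g ∈ posPart G, c₁ * reE g ^ (-ν₁) ≤ ‖chi q g - 1‖) :
    ∃ D : ℝ ×ₗ ℝ → ℝ, Controlled G D ∧
      ∀ g ∈ posPart G, max 1 ‖chi q g‖ ^ n ≤ D g * ‖L.eval (m * chi q g)‖ := by
  have hA : 0 < ‖L.leadingCoeff‖ := norm_pos_iff.2 (Polynomial.leadingCoeff_ne_zero.2 hL)
  refine ⟨fun g => ‖L.leadingCoeff‖⁻¹ *
    (L.roots.map fun a => max 1 ‖chi q g‖ * ‖m * chi q g - a‖⁻¹).prod, ?_, fun g hg => ?_⟩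
  · refine (Controlled.multiset_prod L.roots (fun a g => max 1 ‖chi q g‖ * ‖m * chi q g - a‖⁻¹)
      (fun a ha => (hroot a ha).controlled hm hre hc₁ hν₁ hdio₁)
      fun a ha g hg => by positivity).mono (by positivity) fun g hg => le_rfl
  · have h1 : ‖L.eval (m * chi q g)‖ =
        ‖L.leadingCoeff‖ * (L.roots.map fun a => ‖m * chi q g - a‖).prod := by
      have h3 := map_multiset_prod (normHom (α := ℂ)) (L.roots.map fun a => m * chi q g - a)
      rw [Multiset.map_map] at h3
      rw [(IsAlgClosed.splits L).eval_eq_prod_roots, norm_mul]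
      congr 1
    have h2 : ((L.roots.map fun a => max 1 ‖chi q g‖ * ‖m * chi q g - a‖⁻¹).prod) *
        (L.roots.map fun a => ‖m * chi q g - a‖).prod = max 1 ‖chi q g‖ ^ L.roots.card := by
      rw [← Multiset.prod_map_mul]
      have : ∀ a ∈ L.roots, max 1 ‖chi q g‖ * ‖m * chi q g - a‖⁻¹ * ‖m * chi q g - a‖ =
          max 1 ‖chi q g‖ := fun a ha => by
        rw [mul_assoc, inv_mul_cancel₀ ((hroot a ha).pos hre hg).ne', mul_one]
      rw [Multiset.map_congr rfl this, Multiset.map_const', Multiset.prod_replicate]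
    rw [h1]
    calc _ ≤ max 1 ‖chi q g‖ ^ L.roots.card := hW g hg
      _ = _ := by rw [← h2]; field_simp

open MvPolynomial (aeval C X pderiv coeff bind₁)

/-! ### Affine substitutions in a polynomial -/

section AffineSubst

variable {K R ι : Type*} [CommRing K] [CommRing R] [Algebra K R]

/-- The polynomial `F(z, a_k + b_k X_k)` in the variables `X_k`. -/
noncomputable def affineSubst (z : R) (a b : ι → R) (F : MvPolynomial (Option ι) K) :
    MvPolynomial ι R :=
  aeval (fun o : Option ι => o.elim (C z) fun k => C (a k) + C (b k) * X k) F

theorem algHom_affineSubst {B : Type*} [CommRing B] [Algebra K B] [Algebra R B]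
    [IsScalarTower K R B] (f : MvPolynomial ι R →ₐ[R] B) (z : R) (a b : ι → R)
    (F : MvPolynomial (Option ι) K) :
    f (affineSubst z a b F) = aeval (fun o : Option ι => o.elim (algebraMap R B z) fun k =>
      algebraMap R B (a k) + algebraMap R B (b k) * f (X k)) F := by
  have h := MvPolynomial.comp_aeval_apply
    (fun o : Option ι => o.elim (C z) fun k => C (a k) + C (b k) * X k) (f.restrictScalars K) F
  rw [affineSubst]
  refine h.trans ?_
  congr 2
  funext o
  cases o <;> simp

theorem aeval_affineSubst (w : ι → R) (z : R) (a b : ι → R) (F : MvPolynomial (Option ι) K) :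
    MvPolynomial.eval w (affineSubst z a b F) =
      aeval (fun o : Option ι => o.elim z fun k => a k + b k * w k) F := by
  have h := algHom_affineSubst (aeval w : MvPolynomial ι R →ₐ[R] R) z a b F
  simp only [MvPolynomial.aeval_X, Algebra.algebraMap_self, RingHom.id_apply] at h
  rw [← h, MvPolynomial.aeval_eq_eval]

theorem bind₁_add_affineSubst (w : ι → R) (z : R) (a b : ι → R) (F : MvPolynomial (Option ι) K) :
    bind₁ (fun k => X k + C (w k)) (affineSubst z a b F) =
      affineSubst z (fun k => a k + b k * w k) b F := by
  have h : (fun o : Option ι => o.elim (algebraMap R (MvPolynomial ι R) z) fun k =>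
      algebraMap R _ (a k) + algebraMap R _ (b k) * bind₁ (fun k => X k + C (w k)) (X k)) =
      fun o : Option ι => o.elim (C z) fun k => C (a k + b k * w k) + C (b k) * X k := by
    funext o
    cases o with
    | none => simp only [Option.elim, MvPolynomial.algebraMap_eq]
    | some k =>
      simp only [Option.elim, MvPolynomial.bind₁_X_right, MvPolynomial.algebraMap_eq, C.map_add,
        C.map_mul]
      ring
  exact (algHom_affineSubst _ z a b F).trans (by rw [h, affineSubst])

theorem bind₁_mul_affineSubst (c : ι → R) (z : R) (a b : ι → R) (F : MvPolynomial (Option ι) K) :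
    bind₁ (fun k => C (c k) * X k) (affineSubst z a b F) =
      affineSubst z a (fun k => b k * c k) F := by
  have h : (fun o : Option ι => o.elim (algebraMap R (MvPolynomial ι R) z) fun k =>
      algebraMap R _ (a k) + algebraMap R _ (b k) * bind₁ (fun k => C (c k) * X k) (X k)) =
      fun o : Option ι => o.elim (C z) fun k => C (a k) + C (b k * c k) * X k := by
    funext o
    cases o with
    | none => simp only [Option.elim, MvPolynomial.algebraMap_eq]
    | some k =>
      simp only [Option.elim, MvPolynomial.bind₁_X_right, MvPolynomial.algebraMap_eq, C.map_mul]
      ring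
  exact (algHom_affineSubst _ z a b F).trans (by rw [h, affineSubst])

theorem coeff_bind₁_C_mul_X [Fintype ι] (c : ι → R) (Q : MvPolynomial ι R) (p : ι →₀ ℕ) :
    coeff p (bind₁ (fun k => C (c k) * X k) Q) = coeff p Q * ∏ k, c k ^ p k := by
  classical
  induction Q using MvPolynomial.induction_on' with
  | add Q₁ Q₂ h₁ h₂ => simp only [map_add, MvPolynomial.coeff_add, h₁, h₂, add_mul]
  | monomial s a =>
    have : bind₁ (fun k => C (c k) * X k) (MvPolynomial.monomial s a) =
        MvPolynomial.monomial s (a * ∏ k, c k ^ s k) := by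
      rw [MvPolynomial.bind₁_monomial, MvPolynomial.monomial_eq (s := s) (a := a * _),
        Finset.prod_subset (Finset.subset_univ s.support) (by
          intro k _ hk
          simp [Finsupp.notMem_support_iff.1 hk]),
        Finsupp.prod_fintype _ _ (by simp), Finset.prod_congr rfl fun k _ => mul_pow _ _ _,
        Finset.prod_mul_distrib, map_mul, map_prod]
      simp only [map_pow, mul_assoc]
    rw [this, MvPolynomial.coeff_monomial, MvPolynomial.coeff_monomial]
    split_ifs with h
    · rw [h]
    · simp

theorem coeff_zero_affineSubst (z : R) (a b : ι → R) (F : MvPolynomial (Option ι) K) :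
    coeff 0 (affineSubst z a b F) = aeval (fun o : Option ι => o.elim z a) F := by
  have h := aeval_affineSubst (fun _ => 0) z a b F
  simp only [mul_zero, add_zero] at h
  rw [← h, MvPolynomial.eval_zero', MvPolynomial.constantCoeff_eq]

theorem coeff_single_one (P : MvPolynomial ι R) (k : ι) :
    coeff (Finsupp.single k 1) P = coeff 0 (pderiv k P) := by
  simp [MvPolynomial.coeff_pderiv]

/-- The chain rule for the linear coefficients. -/
theorem coeff_single_affineSubst (z : R) (a b : ι → R) (F : MvPolynomial (Option ι) K) (k : ι) :
    coeff (Finsupp.single k 1) (affineSubst z a b F) =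
      b k * aeval (fun o : Option ι => o.elim z a) (pderiv (some k) F) := by
  rw [coeff_single_one]
  have hzero := fun p : MvPolynomial (Option ι) K => coeff_zero_affineSubst z a b p
  simp only [affineSubst] at hzero ⊢
  have hmul : ∀ a b : MvPolynomial ι R, coeff 0 (a * b) = coeff 0 a * coeff 0 b := fun a b => by
    simpa [MvPolynomial.constantCoeff_eq] using map_mul MvPolynomial.constantCoeff a b
  induction F using MvPolynomial.induction_on with
  | C r =>
    rw [MvPolynomial.algHom_C, IsScalarTower.algebraMap_apply K R (MvPolynomial ι R),
      MvPolynomial.algebraMap_eq]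
    simp
  | add p r hp hr => simp only [map_add, MvPolynomial.coeff_add, hp, hr, mul_add]
  | mul_X p o hp =>
    rw [map_mul, MvPolynomial.pderiv_mul, MvPolynomial.pderiv_mul, MvPolynomial.coeff_add, hmul,
      hmul, hp, hzero p, hzero (X o)]
    cases o with
    | none => simp [MvPolynomial.pderiv_X_of_ne]; ring
    | some l =>
      by_cases h : l = k
      · subst h; simp; ring
      · simp [MvPolynomial.pderiv_X_of_ne h,
          MvPolynomial.pderiv_X_of_ne (fun h' : some l = some k => h (Option.some.inj h'))]
        ring

/-- The coefficients of `F(z, a_k + b_k X_k)` lie in every subalgebra that contains `z`, the `a_k`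
and the `b_k`. -/
theorem coeff_affineSubst_mem (S : Subalgebra K R) {z : R} {a b : ι → R} (hz : z ∈ S)
    (ha : ∀ k, a k ∈ S) (hb : ∀ k, b k ∈ S) (F : MvPolynomial (Option ι) K) (p : ι →₀ ℕ) :
    coeff p (affineSubst z a b F) ∈ S := by
  classical
  have hX : ∀ (o : Option ι) (p : ι →₀ ℕ),
      coeff p (o.elim (C z) fun k => C (a k) + C (b k) * X k : MvPolynomial ι R) ∈ S := by
    intro o p
    cases o with
    | none =>
      simp only [Option.elim, MvPolynomial.coeff_C]
      split_ifs
      exacts [hz, S.zero_mem]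
    | some k =>
      simp only [Option.elim, MvPolynomial.coeff_add, MvPolynomial.coeff_C,
        MvPolynomial.coeff_C_mul, MvPolynomial.coeff_X]
      refine S.add_mem ?_ (S.mul_mem (hb k) ?_) <;> split_ifs
      exacts [ha k, S.zero_mem, S.one_mem, S.zero_mem]
  rw [affineSubst]
  induction F using MvPolynomial.induction_on generalizing p with
  | C r =>
    rw [MvPolynomial.algHom_C, IsScalarTower.algebraMap_apply K R (MvPolynomial ι R),
      MvPolynomial.algebraMap_eq, MvPolynomial.coeff_C]
    split_ifs
    exacts [S.algebraMap_mem r, S.zero_mem]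
  | add p r hp hr =>
    rw [map_add, MvPolynomial.coeff_add]
    exact S.add_mem (hp _) (hr _)
  | mul_X F o hF =>
    rw [map_mul, MvPolynomial.coeff_mul]
    refine S.sum_mem fun i _ => S.mul_mem (hF _) ?_
    rw [MvPolynomial.aeval_X]
    exact hX o _

end AffineSubst

/-! ### The reduced equation -/

/-- The subring of Hahn series with exponents in a submonoid. -/
noncomputable def suppSubring (G : AddSubmonoid (ℝ ×ₗ ℝ)) : Subring FormalSeries where
  carrier := {x | SuppIn (G : Set (ℝ ×ₗ ℝ)) x}
  mul_mem' hx hy := suppIn_mul hx hy fun _ hg _ hg' => G.add_mem hg hg'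
  one_mem' := suppIn_single G.zero_mem 1
  add_mem' hx hy := suppIn_add hx hy
  zero_mem' := fun g hg => absurd (by simp) hg
  neg_mem' hx := suppIn_neg hx

/-- The subalgebra of Hahn series with finitely many terms. -/
noncomputable def finiteSubalgebra : Subalgebra ℂ FormalSeries where
  carrier := {x | x.support.Finite}
  mul_mem' {x y} hx hy := (hx.add hy).subset HahnSeries.support_mul_subset
  add_mem' {x y} hx hy := (hx.union hy).subset (HahnSeries.support_add_subset x y)
  algebraMap_mem' r := by
    refine (Set.finite_singleton (0 : ℝ ×ₗ ℝ)).subset ?_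
    rw [HahnSeries.algebraMap_apply, HahnSeries.C_apply]
    exact HahnSeries.support_single_subset

theorem single_mem_finiteSubalgebra (g : ℝ ×ₗ ℝ) (c : ℂ) :
    HahnSeries.single g c ∈ finiteSubalgebra :=
  (Set.finite_singleton g).subset HahnSeries.support_single_subset

theorem dilPow_mem_finiteSubalgebra (q : ℂ) (k : ℕ) {x : FormalSeries}
    (hx : x ∈ finiteSubalgebra) : dilPow q k x ∈ finiteSubalgebra := by
  refine Set.Finite.subset hx fun g hg => ?_
  have h : (dilPow q k x).coeff g ≠ 0 := hg
  rw [dilPow_coeff] at h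
  exact right_ne_zero_of_mul h

section Gap

variable {G : AddSubmonoid (ℝ ×ₗ ℝ)}

theorem coeff_zero_mul_of_suppIn (hre : ∀ g ∈ posPart G, 0 < reE g) {x y : FormalSeries}
    (hx : SuppIn (G : Set (ℝ ×ₗ ℝ)) x) (hy : SuppIn (G : Set (ℝ ×ₗ ℝ)) y) :
    (x * y).coeff 0 = x.coeff 0 * y.coeff 0 := by
  have hpos : ∀ g ∈ G, 0 ≤ reE g ∧ (reE g = 0 → g = 0) := by
    intro g hg
    by_cases h : g = 0
    · simp [h]
    · have := hre g ⟨hg, h⟩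
      exact ⟨this.le, fun h' => absurd h' this.ne'⟩
  rw [HahnSeries.coeff_mul, Finset.sum_eq_single (0, 0)]
  · intro p hp hne
    rw [Finset.mem_antidiagonal] at hp
    obtain ⟨h1, h2, h3⟩ := hp
    have h4 : reE p.1 + reE p.2 = 0 := by rw [← map_add, h3, map_zero]
    have h5 := hpos p.1 (hx _ h1)
    have h6 := hpos p.2 (hy _ h2)
    exact absurd (Prod.ext (h5.2 (by linarith)) (h6.2 (by linarith))) hne
  · intro h
    rw [Finset.mem_antidiagonal] at h
    by_contra h'
    exact h ⟨left_ne_zero_of_mul h', right_ne_zero_of_mul h', add_zero 0⟩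

/-- The coefficient of `z ^ 0`, a ring homomorphism on the series with exponents in `G`. -/
noncomputable def coeffZeroHom (hre : ∀ g ∈ posPart G, 0 < reE g) : suppSubring G →+* ℂ where
  toFun x := x.1.coeff 0
  map_one' := by simp
  map_zero' := by simp
  map_add' x y := by simp
  map_mul' x y := coeff_zero_mul_of_suppIn hre x.2 y.2

/-- Translating the variables by series without constant term changes neither the property that
all exponents lie in `G` nor the coefficients of `z ^ 0`. -/
theorem bind₁_translate {ι : Type*} (hre : ∀ g ∈ posPart G, 0 < reE g)
    {Q : MvPolynomial ι FormalSeries} (hQ : ∀ p, SuppIn (G : Set (ℝ ×ₗ ℝ)) (coeff p Q))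
    {w : ι → FormalSeries} (hw : ∀ k, SuppIn (posPart G) (w k)) (p : ι →₀ ℕ) :
    SuppIn (G : Set (ℝ ×ₗ ℝ)) (coeff p (bind₁ (fun k => X k + C (w k)) Q)) ∧
      (coeff p (bind₁ (fun k => X k + C (w k)) Q)).coeff 0 = (coeff p Q).coeff 0 := by
  obtain ⟨Q', rfl⟩ : Q ∈ Set.range (MvPolynomial.map (suppSubring G).subtype) := by
    rw [MvPolynomial.mem_range_map_iff_coeffs_subset]
    intro x hx
    obtain ⟨p, -, rfl⟩ := MvPolynomial.mem_coeffs_iff.1 hx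
    exact ⟨⟨_, hQ p⟩, rfl⟩
  let w' : ι → suppSubring G := fun k => ⟨w k, (hw k).mono (posPart_subset G)⟩
  have h1 : bind₁ (fun k => X k + C (w k)) (MvPolynomial.map (suppSubring G).subtype Q') =
      MvPolynomial.map (suppSubring G).subtype (bind₁ (fun k => X k + C (w' k)) Q') := by
    rw [MvPolynomial.map_bind₁]
    simp only [MvPolynomial.map_X, MvPolynomial.map_C, (MvPolynomial.map _).map_add]
    rfl
  have h2 : MvPolynomial.map (coeffZeroHom hre) (bind₁ (fun k => X k + C (w' k)) Q') =
      MvPolynomial.map (coeffZeroHom hre) Q' := by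
    have h3 : ∀ k, coeffZeroHom hre (w' k) = 0 := fun k => by
      by_contra h
      exact (hw k 0 h).2 rfl
    rw [MvPolynomial.map_bind₁]
    simp only [MvPolynomial.map_X, MvPolynomial.map_C, (MvPolynomial.map _).map_add, h3, C.map_zero,
      add_zero]
    rw [MvPolynomial.bind₁_X_left]
    rfl
  rw [h1, MvPolynomial.coeff_map, MvPolynomial.coeff_map]
  refine ⟨(coeff p (bind₁ (fun k => X k + C (w' k)) Q')).2, ?_⟩
  have := congrArg (coeff p) h2
  rwa [MvPolynomial.coeff_map, MvPolynomial.coeff_map] at this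

end Gap

variable {n : ℕ}

/-- The polynomial `F(z, x + v X_0, σ x + σ v X_1, …)` in the variables `X_k`, which stand for
`σ ^ k u` after the substitution `y = x + v u`. -/
noncomputable def shiftPoly (q : ℂ) (F : MvPolynomial (Option (Fin (n + 1))) ℂ)
    (x v : FormalSeries) : MvPolynomial (Fin (n + 1)) FormalSeries :=
  affineSubst (mono 1 1) (fun k : Fin (n + 1) => dilPow q k x)
    (fun k : Fin (n + 1) => dilPow q k v) F

theorem shiftedPoly_eq (q : ℂ) (F : MvPolynomial (Option (Fin (n + 1))) ℂ) (φ : GenPowerSeries)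
    (j₀ : ℕ) :
    shiftedPoly q F φ j₀ = shiftPoly q F (φ.initial j₀) (mono (φ.lam j₀) 1) := by
  simp only [shiftedPoly, shiftPoly, affineSubst, iterate_dil]

theorem substSeries_eq (q : ℂ) (F : MvPolynomial (Option (Fin (n + 1))) ℂ) (x : FormalSeries) :
    substSeries q F x =
      aeval (fun o => o.elim (mono 1 1) fun k : Fin (n + 1) => dilPow q k x) F := by
  simp only [substSeries, iterate_dil]

theorem eval_shiftPoly (q : ℂ) (F : MvPolynomial (Option (Fin (n + 1))) ℂ)
    (x v u : FormalSeries) :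
    MvPolynomial.eval (fun k : Fin (n + 1) => dilPow q k u) (shiftPoly q F x v) =
      substSeries q F (x + v * u) := by
  rw [substSeries_eq, shiftPoly, aeval_affineSubst]
  simp only [map_add, map_mul]

theorem bind₁_shiftPoly (q : ℂ) (F : MvPolynomial (Option (Fin (n + 1))) ℂ)
    (x v u : FormalSeries) :
    bind₁ (fun k : Fin (n + 1) => X k + C (dilPow q k u)) (shiftPoly q F x v) =
      shiftPoly q F (x + v * u) v := by
  rw [shiftPoly, shiftPoly, bind₁_add_affineSubst]
  simp only [(dilPow q _).map_add, (dilPow q _).map_mul]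

theorem coeff_shiftPoly (q : ℂ) (F : MvPolynomial (Option (Fin (n + 1))) ℂ)
    (x v : FormalSeries) (p : Fin (n + 1) →₀ ℕ) :
    coeff p (shiftPoly q F x v) =
      coeff p (shiftPoly q F x 1) * ∏ k : Fin (n + 1), dilPow q k v ^ p k := by
  rw [shiftPoly, shiftPoly, ← coeff_bind₁_C_mul_X, bind₁_mul_affineSubst]
  simp only [(dilPow q _).map_one, one_mul]

theorem coeff_zero_shiftPoly (q : ℂ) (F : MvPolynomial (Option (Fin (n + 1))) ℂ)
    (x v : FormalSeries) : coeff 0 (shiftPoly q F x v) = substSeries q F x := by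
  rw [shiftPoly, coeff_zero_affineSubst, substSeries_eq]

theorem coeff_single_shiftPoly (q : ℂ) (F : MvPolynomial (Option (Fin (n + 1))) ℂ)
    (x v : FormalSeries) (k : Fin (n + 1)) :
    coeff (Finsupp.single k 1) (shiftPoly q F x v) =
      dilPow q k v * substSeries q (pderiv (some k) F) x := by
  rw [shiftPoly, coeff_single_affineSubst, substSeries_eq]

theorem finite_support_coeff_shiftPoly (q : ℂ) (F : MvPolynomial (Option (Fin (n + 1))) ℂ)
    {x v : FormalSeries} (hx : x ∈ finiteSubalgebra) (hv : v ∈ finiteSubalgebra)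
    (p : Fin (n + 1) →₀ ℕ) : coeff p (shiftPoly q F x v) ∈ finiteSubalgebra :=
  coeff_affineSubst_mem finiteSubalgebra (single_mem_finiteSubalgebra _ _)
    (fun k : Fin (n + 1) => dilPow_mem_finiteSubalgebra q k hx)
    (fun k => dilPow_mem_finiteSubalgebra q k hv) F p

/-- The polynomial of the substitution `y = x + z ^ μ u`, divided by `z ^ ω`. -/
noncomputable def reducedPoly (q : ℂ) (F : MvPolynomial (Option (Fin (n + 1))) ℂ) (μ ω : ℂ)
    (x : FormalSeries) : MvPolynomial (Fin (n + 1)) FormalSeries :=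
  C (mono (-ω) 1) * shiftPoly q F x (mono μ 1)

theorem coeff_reducedPoly (q : ℂ) (F : MvPolynomial (Option (Fin (n + 1))) ℂ) (μ ω : ℂ)
    (x : FormalSeries) (p : Fin (n + 1) →₀ ℕ) (g : ℝ ×ₗ ℝ) :
    (coeff p (reducedPoly q F μ ω x)).coeff g =
      (coeff p (shiftPoly q F x (mono μ 1))).coeff (g + expo ω) := by
  rw [reducedPoly, MvPolynomial.coeff_C_mul, mono, HahnSeries.coeff_single_mul, one_mul, expo_neg,
    sub_neg_eq_add]

theorem bind₁_reducedPoly (q : ℂ) (F : MvPolynomial (Option (Fin (n + 1))) ℂ) (μ ω : ℂ)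
    (x u : FormalSeries) :
    bind₁ (fun k : Fin (n + 1) => X k + C (dilPow q k u)) (reducedPoly q F μ ω x) =
      reducedPoly q F μ ω (x + mono μ 1 * u) := by
  rw [reducedPoly, reducedPoly, map_mul (bind₁ _), MvPolynomial.bind₁_C_right, bind₁_shiftPoly]

/-- If `φ = x + z ^ μ u` solves the equation, if the coefficients of the reduced equation for `u` and
`u` itself only involve exponents in `G`, and if the divisors are controlled, then `u` converges
absolutely. -/
theorem exists_wnorm_lt_top_of_controlled (q : ℂ) (F : MvPolynomial (Option (Fin (n + 1))) ℂ)
    {μ κ : ℂ} {x u : FormalSeries} (hx : x ∈ finiteSubalgebra)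
    (hsol : substSeries q F (x + mono μ 1 * u) = 0)
    {G : AddSubmonoid (ℝ ×ₗ ℝ)} {δ : ℝ} (hδ : 0 < δ) (hG : ∀ g ∈ posPart G, δ ≤ reE g)
    (hu : SuppIn (posPart G) u)
    (hP : ∀ p, SuppIn (G : Set (ℝ ×ₗ ℝ)) (coeff p (reducedPoly q F μ (μ + κ) x)))
    {L : Polynomial ℂ} (hL : L = ∑ k : Fin (n + 1), Polynomial.C
      ((substSeries q (pderiv (some k) F) (x + mono μ 1 * u)).coeff (expo κ)) *
        Polynomial.X ^ (k : ℕ))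
    {D : ℝ ×ₗ ℝ → ℝ} (hD : Controlled G D)
    (hDL : ∀ g, u.coeff g ≠ 0 → max 1 ‖chi q g‖ ^ n ≤ D g * ‖L.eval (qPow q μ * chi q g)‖) :
    ∃ ρ : ℝ, 0 < ρ ∧ wnorm (fun g => ENNReal.ofReal (ρ ^ reE g)) u < ∞ := by
  classical
  have hre : ∀ g ∈ posPart G, 0 < reE g := fun g hg => hδ.trans_le (hG g hg)
  set φ := x + mono μ 1 * u with hφ
  set P := reducedPoly q F μ (μ + κ) x with hPdef
  set A : Fin (n + 1) → ℂ :=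
    fun k => (substSeries q (pderiv (some k) F) φ).coeff (expo κ) with hA
  set ℓ : Fin (n + 1) → ℂ := fun k => qPow q μ ^ (k : ℕ) * A k with hℓ
  have htr := bind₁_translate hre hP (w := fun k : Fin (n + 1) => dilPow q k u)
    fun k => suppIn_dilPow q k hu
  rw [bind₁_reducedPoly, ← hφ] at htr
  have hP0 : (coeff 0 P).coeff 0 = 0 := by
    rw [← (htr 0).2, coeff_reducedPoly, coeff_zero_shiftPoly, hsol, HahnSeries.coeff_zero]
  have hP1 : ∀ k, (coeff (Finsupp.single k 1) P).coeff 0 = ℓ k := by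
    intro k
    rw [← (htr _).2, coeff_reducedPoly, coeff_single_shiftPoly, mono, dilPow_single,
      HahnSeries.coeff_single_mul, zero_add, expo_add, add_sub_cancel_left, mul_one, chi_expo]
  have hPev : MvPolynomial.eval (fun k : Fin (n + 1) => dilPow q k u) P = 0 := by
    rw [hPdef, reducedPoly, map_mul, eval_shiftPoly, ← hφ, hsol, mul_zero]
  set Q := P - ∑ k : Fin (n + 1), C (HahnSeries.single 0 (ℓ k)) * X k with hQdef
  have hQc : ∀ p, coeff p Q =
      coeff p P - ∑ k : Fin (n + 1), if Finsupp.single k 1 = p then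
        HahnSeries.single (0 : ℝ ×ₗ ℝ) (ℓ k) else 0 := by
    intro p
    rw [hQdef, MvPolynomial.coeff_sub, MvPolynomial.coeff_sum]
    simp only [MvPolynomial.coeff_C_mul, MvPolynomial.coeff_X, mul_ite, mul_one, mul_zero]
  have hlin : ∀ (S : Subring FormalSeries), (∀ c : ℂ, HahnSeries.single 0 c ∈ S) →
      ∀ p, coeff p P ∈ S → coeff p Q ∈ S := by
    intro S hS p hp
    rw [hQc]
    refine S.sub_mem hp (S.sum_mem fun k _ => ?_)
    split_ifs
    exacts [hS _, S.zero_mem]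
  have hQ0 : (coeff 0 Q).coeff 0 = 0 := by
    rw [hQc, Finset.sum_eq_zero fun k _ => if_neg (by simp), sub_zero, hP0]
  have hQ1 : ∀ k, (coeff (Finsupp.single k 1) Q).coeff 0 = 0 := by
    intro k
    rw [hQc, Finset.sum_eq_single k, if_pos rfl, HahnSeries.coeff_sub, hP1]
    · simp
    · intro l _ hl
      exact if_neg fun h => hl (Finsupp.single_left_injective one_ne_zero h)
    · simp
  obtain ⟨C₀, H, h, b, hC₀, hb, hadd⟩ := hD
  have hpp : ∀ g ∈ posPart G, ∀ g' ∈ posPart G, g + g' ∈ posPart G := fun g hg g' hg' =>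
    add_mem_posPart hδ hG hg.1 hg'
  refine exists_wnorm_lt_top (n := n) q hδ hG ℓ (Q := Q)
    (hlin (suppSubring G) (fun c => suppIn_single G.zero_mem c) · (hP _))
    (hlin finiteSubalgebra.toSubring (fun c => single_mem_finiteSubalgebra 0 c) · ?_)
    (fun p hp => ?_) hu ?_ (h := fun g => if g = 0 then 0 else h g) (b := b) (by simp)
    (fun g hg => ?_) (fun g hg g' hg' => ?_) hC₀ (fun g hg => ?_) (H := H) fun g hg => ?_
  · rw [hPdef, reducedPoly, MvPolynomial.coeff_C_mul]
    exact finiteSubalgebra.mul_mem (single_mem_finiteSubalgebra _ _)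
      (finite_support_coeff_shiftPoly q F hx (single_mem_finiteSubalgebra _ _) _)
  · by_cases hp0 : p = 0
    · rw [hp0, hQ0]
    · obtain ⟨k, d, rfl⟩ := exists_eq_single_add hp0
      have hd : d = 0 := by
        rw [← Finsupp.degree_eq_zero_iff]
        rw [map_add, Finsupp.degree_single] at hp
        omega
      rw [hd, add_zero, hQ1]
  · rw [hQdef, map_sub, hPev, map_sum]
    simp only [map_mul, MvPolynomial.eval_C, MvPolynomial.eval_X]
    ring
  · simp only [if_neg hg.2]
    exact ⟨(hb g hg).1, (hb g hg).2.1⟩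
  · simp only [if_neg hg.2, if_neg hg'.2, if_neg (hpp g hg g' hg').2]
    exact hadd g hg g' hg'
  · have hLeval : L.eval (qPow q μ * chi q g) =
        ∑ k : Fin (n + 1), ℓ k * chi q g ^ (k : ℕ) := by
      rw [hL, Polynomial.eval_finsetSum]
      refine Finset.sum_congr rfl fun k _ => ?_
      simp only [Polynomial.eval_mul, Polynomial.eval_C, Polynomial.eval_pow, Polynomial.eval_X,
        hℓ, hA, mul_pow]
      ring
    rw [← hLeval]
    refine (hDL g hg).trans ?_
    gcongr
    exact (hb g (hu g hg)).2.2.2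
  · simp only [if_neg hg.2]
    exact (hb g hg).2.2.1

/-! ### Tails of a generalized power series -/

theorem expo_lam_injective (φ : GenPowerSeries) :
    Function.Injective fun j => expo (φ.lam j) :=
  expo_injective.comp φ.lam_injective

theorem coeff_series (φ : GenPowerSeries) (j : ℕ) :
    φ.series.coeff (expo (φ.lam j)) = φ.c j :=
  (expo_lam_injective φ).extend_apply φ.c 0 j

theorem exists_of_coeff_series_ne_zero (φ : GenPowerSeries) {g : ℝ ×ₗ ℝ}
    (h : φ.series.coeff g ≠ 0) : ∃ j, g = expo (φ.lam j) := by
  by_contra! H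
  exact h (Function.extend_apply' _ _ _ fun ⟨j, hj⟩ => H j hj.symm)

theorem coeff_initial (φ : GenPowerSeries) (j₀ j : ℕ) :
    (φ.initial j₀).coeff (expo (φ.lam j)) = if j ≤ j₀ then φ.c j else 0 := by
  classical
  simp only [GenPowerSeries.initial, HahnSeries.coeff_sum, mono, HahnSeries.coeff_single]
  have : ∀ i, (expo (φ.lam j) = expo (φ.lam i)) ↔ j = i :=
    fun i => (expo_lam_injective φ).eq_iff
  simp [this]

theorem exists_of_coeff_initial_ne_zero (φ : GenPowerSeries) (j₀ : ℕ) {g : ℝ ×ₗ ℝ}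
    (h : (φ.initial j₀).coeff g ≠ 0) : ∃ j, g = expo (φ.lam j) := by
  classical
  by_contra! H
  refine h ?_
  simp only [GenPowerSeries.initial, HahnSeries.coeff_sum, mono]
  exact Finset.sum_eq_zero fun i _ => HahnSeries.coeff_single_of_ne (H i)

theorem initial_mem_finiteSubalgebra (φ : GenPowerSeries) (j₀ : ℕ) :
    φ.initial j₀ ∈ finiteSubalgebra :=
  finiteSubalgebra.sum_mem fun _ _ => single_mem_finiteSubalgebra _ _

/-- The series `u` of the substitution `φ = ∑_{j ≤ j₀} c_j z ^ {lam_j} + z ^ μ u`. -/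
noncomputable def tail (φ : GenPowerSeries) (j₀ : ℕ) (μ : ℂ) : FormalSeries :=
  mono (-μ) 1 * (φ.series - φ.initial j₀)

theorem initial_add_tail (φ : GenPowerSeries) (j₀ : ℕ) (μ : ℂ) :
    φ.initial j₀ + mono μ 1 * tail φ j₀ μ = φ.series := by
  have h : mono μ 1 * mono (-μ) 1 = 1 := by
    rw [mono, mono, HahnSeries.single_mul_single, ← expo_add, add_neg_cancel, mul_one]
    rfl
  rw [tail, ← mul_assoc, h, one_mul, add_sub_cancel]

theorem coeff_tail (φ : GenPowerSeries) (j₀ : ℕ) (μ : ℂ) (g : ℝ ×ₗ ℝ) :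
    (tail φ j₀ μ).coeff g = (φ.series - φ.initial j₀).coeff (g + expo μ) := by
  rw [tail, mono, HahnSeries.coeff_single_mul, one_mul, expo_neg, sub_neg_eq_add]

theorem coeff_tail_expo (φ : GenPowerSeries) (j₀ : ℕ) (μ : ℂ) (j : ℕ) :
    (tail φ j₀ μ).coeff (expo (φ.lam j - μ)) = if j ≤ j₀ then 0 else φ.c j := by
  rw [coeff_tail, ← expo_add, sub_add_cancel, HahnSeries.coeff_sub, coeff_series, coeff_initial]
  split_ifs <;> simp

theorem exists_of_coeff_tail_ne_zero (φ : GenPowerSeries) (j₀ : ℕ) (μ : ℂ) {g : ℝ ×ₗ ℝ}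
    (h : (tail φ j₀ μ).coeff g ≠ 0) :
    ∃ j, j₀ < j ∧ φ.c j ≠ 0 ∧ g = expo (φ.lam j - μ) := by
  obtain ⟨j, hj⟩ : ∃ j, g + expo μ = expo (φ.lam j) := by
    by_contra! H
    rw [coeff_tail, HahnSeries.coeff_sub] at h
    have h1 : φ.series.coeff (g + expo μ) = 0 := by
      by_contra h1
      obtain ⟨j, hj⟩ := exists_of_coeff_series_ne_zero φ h1
      exact H j hj
    have h2 : (φ.initial j₀).coeff (g + expo μ) = 0 := by
      by_contra h2
      obtain ⟨j, hj⟩ := exists_of_coeff_initial_ne_zero φ j₀ h2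
      exact H j hj
    exact h (by rw [h1, h2, sub_zero])
  have hg : g = expo (φ.lam j - μ) := by rw [expo_sub, ← hj, add_sub_cancel_right]
  rw [hg, coeff_tail_expo] at h
  split_ifs at h with hle
  · exact absurd rfl h
  · exact ⟨j, not_le.1 hle, h, hg⟩

theorem summable_of_wnorm_tail (φ : GenPowerSeries) (j₀ : ℕ) (μ : ℂ) {ρ : ℝ} (hρ : 0 < ρ)
    (h : wnorm (fun g => ENNReal.ofReal (ρ ^ reE g)) (tail φ j₀ μ) < ∞) :
    Summable fun j => ‖φ.c j‖ * ρ ^ (φ.lam j).re := by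
  set f : ℕ → ℝ := fun j => ρ ^ (φ.lam j - μ).re * ‖(tail φ j₀ μ).coeff (expo (φ.lam j - μ))‖
    with hf
  have hinj : Function.Injective fun j => expo (φ.lam j - μ) := fun a b hab =>
    φ.lam_injective (sub_left_injective (expo_injective hab))
  have h1 : Summable f := by
    refine summable_of_sum_le (c := (wnorm (fun g => ENNReal.ofReal (ρ ^ reE g))
      (tail φ j₀ μ)).toReal) (fun j => by positivity) fun s => ?_
    rw [← ENNReal.ofReal_le_iff_le_toReal h.ne, ENNReal.ofReal_sum_of_nonneg
      fun j _ => by positivity]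
    calc ∑ j ∈ s, ENNReal.ofReal (f j) ≤ ∑' j, ENNReal.ofReal (f j) := ENNReal.sum_le_tsum s
      _ = ∑' j, (fun g => ENNReal.ofReal (ρ ^ reE g) * ‖(tail φ j₀ μ).coeff g‖ₑ)
            (expo (φ.lam j - μ)) := by
          refine tsum_congr fun j => ?_
          simp only [hf]
          rw [ENNReal.ofReal_mul (by positivity), ofReal_norm, reE_expo]
      _ ≤ _ := ENNReal.tsum_comp_le_tsum_of_injective hinj _
  refine (summable_nat_add_iff (j₀ + 1)).1 ?_
  refine (((summable_nat_add_iff (j₀ + 1)).2 h1).mul_left (ρ ^ μ.re)).congr fun j => ?_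
  simp only [hf]
  rw [coeff_tail_expo, if_neg (by omega), ← mul_assoc, ← Real.rpow_add hρ, Complex.sub_re,
    add_sub_cancel, mul_comm]

/-! ### Convergence in sectors -/

theorem logBranch_re (θ : ℝ) (z : ℂ) : (logBranch θ z).re = Real.log ‖z‖ := by
  have : ‖Complex.exp (-(θ * Complex.I))‖ = 1 := by
    rw [← neg_mul, ← Complex.ofReal_neg, Complex.norm_exp_ofReal_mul_I]
  simp [logBranch, Complex.log_re, this]

theorem abs_logBranch_im_le (θ : ℝ) (z : ℂ) : |(logBranch θ z).im| ≤ Real.pi + |θ| := by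
  have h : (logBranch θ z).im = (z * Complex.exp (-(θ * Complex.I))).arg + θ := by
    simp [logBranch, Complex.log_im]
  rw [h]
  exact (abs_add_le _ _).trans (by gcongr; exact Complex.abs_arg_le_pi _)

theorem mem_slitPlane_of_abs_arg_lt {z : ℂ} (h0 : z ≠ 0) (h : |z.arg| < Real.pi) :
    z ∈ Complex.slitPlane := by
  rw [Complex.mem_slitPlane_iff_arg]
  exact ⟨fun h' => by rw [h', abs_of_pos Real.pi_pos] at h; exact lt_irrefl _ h, h0⟩

theorem mul_exp_mem_slitPlane {θ δ r : ℝ} (hδ : δ < Real.pi) {z : ℂ} (hz : z ∈ sector θ δ r) :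
    z * Complex.exp (-(θ * Complex.I)) ∈ Complex.slitPlane :=
  mem_slitPlane_of_abs_arg_lt (mul_ne_zero hz.1 (Complex.exp_ne_zero _)) (hz.2.2.trans hδ)

theorem isOpen_sector {θ δ r : ℝ} (hδ : δ < Real.pi) : IsOpen (sector θ δ r) := by
  rw [isOpen_iff_mem_nhds]
  intro z hz
  have hs := mul_exp_mem_slitPlane hδ hz
  have h1 : ∀ᶠ w in nhds z, w ≠ 0 := isOpen_ne.mem_nhds hz.1
  have h2 : ∀ᶠ w in nhds z, ‖w‖ < r := (isOpen_lt continuous_norm continuous_const).mem_nhds hz.2.1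
  have hc : ContinuousAt (fun w => |(w * Complex.exp (-(θ * Complex.I))).arg|) z :=
    ((Complex.continuousAt_arg hs).comp_of_eq (f := fun w => w * Complex.exp (-(θ * Complex.I)))
      (continuous_id.mul continuous_const).continuousAt rfl).abs
  have h3 : ∀ᶠ w in nhds z, |(w * Complex.exp (-(θ * Complex.I))).arg| < δ :=
    hc.eventually_lt continuousAt_const hz.2.2
  filter_upwards [h1, h2, h3] with w a b c using ⟨a, b, c⟩

theorem differentiableOn_logBranch {θ δ r : ℝ} (hδ : δ < Real.pi) :
    DifferentiableOn ℂ (logBranch θ) (sector θ δ r) := fun _ hz =>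
  (((differentiableAt_id.mul_const _).clog (mul_exp_mem_slitPlane hδ hz)).add_const _)
    |>.differentiableWithinAt

/-- Absolute convergence at a positive radius gives uniform convergence in sectors, provided that
the imaginary parts of the exponents are bounded linearly by the real parts. -/
theorem converges_of_summable (φ : GenPowerSeries) {ρ : ℝ} (hρ : 0 < ρ)
    (h : Summable fun j => ‖φ.c j‖ * ρ ^ (φ.lam j).re) {K K' : ℝ} {J : ℕ}
    (hIm : ∀ j, J ≤ j → φ.c j ≠ 0 → |(φ.lam j).im| ≤ K * (φ.lam j).re + K') :
    φ.Converges := by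
  intro B
  set T := Real.pi + |B| with hT
  have hT0 : 0 < T := by positivity
  refine ⟨ρ * Real.exp (-(K * T)), by positivity, fun θ δ hθ hδ0 hδ => ?_⟩
  set r := ρ * Real.exp (-(K * T)) with hr
  have hsum : HasSumUniformlyOn
      (fun j z => φ.c j * Complex.exp (φ.lam j * logBranch θ z))
      (fun z => ∑' j, φ.c j * Complex.exp (φ.lam j * logBranch θ z)) (sector θ δ r) := by
    refine HasSumUniformlyOn.of_norm_le_summable_eventually (h.mul_left (Real.exp (K' * T))) ?_
    rw [Nat.cofinite_eq_atTop]
    filter_upwards [eventually_ge_atTop J, φ.re_tendsto.eventually_ge_atTop 0] with j hj hj0 z hz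
    by_cases hc : φ.c j = 0
    · simp [hc]
    have hz0 : 0 < ‖z‖ := norm_pos_iff.2 hz.1
    have hlog : Real.log ‖z‖ ≤ Real.log ρ - K * T := by
      rw [sub_eq_add_neg, ← Real.log_exp (-(K * T)), ← Real.log_mul hρ.ne' (Real.exp_pos _).ne']
      exact Real.log_le_log hz0 hz.2.1.le
    have hw : |(logBranch θ z).im| ≤ T := by
      linarith [abs_logBranch_im_le θ z, hθ.trans (le_abs_self B)]
    have hprod : -((φ.lam j).im * (logBranch θ z).im) ≤ (K * (φ.lam j).re + K') * T := by
      refine (neg_le_abs _).trans ?_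
      rw [abs_mul]
      exact mul_le_mul (hIm j hj hc) hw (abs_nonneg _) ((abs_nonneg _).trans (hIm j hj hc))
    rw [norm_mul, Complex.norm_exp, Complex.mul_re, logBranch_re]
    have hexp : Real.exp ((φ.lam j).re * Real.log ‖z‖ - (φ.lam j).im * (logBranch θ z).im) ≤
        Real.exp (K' * T) * ρ ^ (φ.lam j).re := by
      rw [Real.rpow_def_of_pos hρ, ← Real.exp_add]
      gcongr
      nlinarith [mul_le_mul_of_nonneg_left hlog hj0]
    calc _ ≤ ‖φ.c j‖ * (Real.exp (K' * T) * ρ ^ (φ.lam j).re) := by gcongr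
      _ = _ := by ring
  refine ⟨_, ?_, hsum⟩
  have h1 := (hasSumUniformlyOn_iff_tendstoUniformlyOn.1 hsum).tendstoLocallyUniformlyOn
  refine h1.differentiableOn (Eventually.of_forall fun s => ?_) (isOpen_sector hδ)
  refine DifferentiableOn.fun_sum fun j _ => ?_
  exact (((differentiableOn_logBranch hδ).const_mul _).cexp).const_mul _

/-! ### Finitely generated semigroups of exponents -/

theorem exists_pos_forall_le {ι : Type*} [Finite ι] (f : ι → ℝ) (hf : ∀ i, 0 < f i) :
    ∃ ε : ℝ, 0 < ε ∧ ∀ i, ε ≤ f i := by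
  rcases isEmpty_or_nonempty ι with h | h
  · exact ⟨1, one_pos, fun i => h.elim i⟩
  · obtain ⟨i, hi⟩ := Finite.exists_min f
    exact ⟨f i, hf i, hi⟩

@[elab_as_elim]
theorem genSemigroup_induction {s : ℕ} {α : Fin s → ℂ} {p : ℂ → Prop} (hα : ∀ i, p (α i))
    (h0 : p 0) (hadd : ∀ a b, p a → p b → p (a + b)) {a : ℂ} (ha : a ∈ genSemigroup α) : p a := by
  induction ha using AddSubmonoid.closure_induction with
  | mem x hx => obtain ⟨i, rfl⟩ := hx; exact hα i
  | zero => exact h0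
  | add x y _ _ hx hy => exact hadd x y hx hy

theorem exists_coeffs_of_mem_genSemigroup {s : ℕ} {α : Fin s → ℂ} {a : ℂ}
    (ha : a ∈ genSemigroup α) : ∃ m : Fin s → ℕ, a = ∑ i, (m i : ℂ) * α i := by
  obtain ⟨m, hm⟩ := AddSubmonoid.mem_closure_range_iff_of_fintype.1 ha
  exact ⟨m, by simpa only [nsmul_eq_mul] using hm⟩

/-- The semigroup generated by the `α_i`, as a submonoid of the ordered group of exponents. -/
noncomputable def expoSemigroup {s : ℕ} (α : Fin s → ℂ) : AddSubmonoid (ℝ ×ₗ ℝ) :=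
  (genSemigroup α).comap expoValHom

theorem mem_expoSemigroup {s : ℕ} {α : Fin s → ℂ} {g : ℝ ×ₗ ℝ} :
    g ∈ expoSemigroup α ↔ expoVal g ∈ genSemigroup α := Iff.rfl

theorem exists_gap_expoSemigroup {s : ℕ} {α : Fin s → ℂ} (hα : ∀ i, 0 < (α i).re) :
    ∃ δ : ℝ, 0 < δ ∧ ∀ m : Fin s → ℕ,
      δ * ((∑ i, m i : ℕ) : ℝ) ≤ (∑ i, (m i : ℂ) * α i).re := by
  obtain ⟨δ, hδ, h⟩ := exists_pos_forall_le (fun i => (α i).re) hα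
  refine ⟨δ, hδ, fun m => ?_⟩
  rw [Complex.re_sum, Nat.cast_sum, Finset.mul_sum]
  refine Finset.sum_le_sum fun i _ => ?_
  rw [← Complex.ofReal_natCast, Complex.re_ofReal_mul, mul_comm]
  gcongr
  exact h i

theorem one_le_sum_of_ne_zero {s : ℕ} {m : Fin s → ℕ} (hm : m ≠ 0) : 1 ≤ ∑ i, m i := by
  obtain ⟨i, hi⟩ := Function.ne_iff.1 hm
  exact (Nat.one_le_iff_ne_zero.2 hi).trans (Finset.single_le_sum (f := m)
    (fun _ _ => Nat.zero_le _) (Finset.mem_univ i))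

theorem exists_coeffs_of_mem_posPart {s : ℕ} {α : Fin s → ℂ} {g : ℝ ×ₗ ℝ}
    (hg : g ∈ posPart (expoSemigroup α)) :
    ∃ m : Fin s → ℕ, m ≠ 0 ∧ expoVal g = ∑ i, (m i : ℂ) * α i := by
  obtain ⟨m, hm⟩ := exists_coeffs_of_mem_genSemigroup (mem_expoSemigroup.1 hg.1)
  refine ⟨m, fun h => hg.2 ?_, hm⟩
  rw [← expo_expoVal g, hm, h]
  simp [expo_zero]

theorem le_reE_of_mem_posPart {s : ℕ} {α : Fin s → ℂ} {δ : ℝ} (hδ : 0 < δ)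
    (h : ∀ m : Fin s → ℕ, δ * ((∑ i, m i : ℕ) : ℝ) ≤ (∑ i, (m i : ℂ) * α i).re) :
    ∀ g ∈ posPart (expoSemigroup α), δ ≤ reE g := by
  intro g hg
  obtain ⟨m, hm, hgm⟩ := exists_coeffs_of_mem_posPart hg
  rw [← re_expoVal, hgm]
  refine le_trans ?_ (h m)
  have : (1 : ℝ) ≤ ((∑ i, m i : ℕ) : ℝ) := by exact_mod_cast one_le_sum_of_ne_zero hm
  nlinarith

theorem exists_abs_im_le {s : ℕ} {α : Fin s → ℂ} (hα : ∀ i, 0 < (α i).re) :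
    ∃ K : ℝ, ∀ a ∈ genSemigroup α, |a.im| ≤ K * a.re := by
  obtain ⟨ε, hε, h⟩ := exists_pos_forall_le (fun i => (α i).re / (1 + |(α i).im|))
    fun i => div_pos (hα i) (by positivity)
  refine ⟨ε⁻¹, fun a ha => ?_⟩
  refine genSemigroup_induction (fun i => ?_) (by simp) (fun a b ha hb => ?_) ha
  · have h1 := h i
    rw [le_div_iff₀ (by positivity)] at h1
    rw [← div_eq_inv_mul, le_div_iff₀ hε]
    linarith
  · rw [Complex.add_im, Complex.add_re, mul_add]
    exact (abs_add_le _ _).trans (add_le_add ha hb)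

/-! ### The modulus of `q ^ a` -/

/-- The real part of `a ln q`. -/
noncomputable def logNorm (q a : ℂ) : ℝ := a.re * Real.log ‖q‖ - a.im * argQ q

theorem norm_qPow (q a : ℂ) : ‖qPow q a‖ = Real.exp (logNorm q a) := by
  rw [qPow, Complex.norm_exp, logNorm]
  congr 1
  simp [lnQ, Complex.mul_re]

theorem logNorm_add (q a b : ℂ) : logNorm q (a + b) = logNorm q a + logNorm q b := by
  simp [logNorm]; ring

theorem logNorm_zero (q : ℂ) : logNorm q 0 = 0 := by simp [logNorm]

theorem exists_logNorm_le {s : ℕ} {q : ℂ} {α : Fin s → ℂ} (hα : ∀ i, 0 < (α i).re)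
    (h : ∀ i, StrictlyAbove q (α i)) :
    ∃ ε : ℝ, 0 < ε ∧ ∀ a ∈ genSemigroup α, logNorm q a ≤ -(ε * a.re) := by
  obtain ⟨ε, hε, hε'⟩ := exists_pos_forall_le (fun i => -logNorm q (α i) / (α i).re)
    fun i => div_pos (by have := h i; simp only [StrictlyAbove] at this; simp only [logNorm]; linarith)
      (hα i)
  refine ⟨ε, hε, fun a ha => genSemigroup_induction (fun i => ?_) (by simp [logNorm_zero])
    (fun a b ha hb => ?_) ha⟩
  · have := hε' i
    rw [le_div_iff₀ (hα i)] at this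
    linarith
  · rw [logNorm_add, Complex.add_re]; linarith

theorem exists_le_logNorm {s : ℕ} {q : ℂ} {α : Fin s → ℂ} (hα : ∀ i, 0 < (α i).re)
    (h : ∀ i, StrictlyUnder q (α i)) :
    ∃ ε : ℝ, 0 < ε ∧ ∀ a ∈ genSemigroup α, ε * a.re ≤ logNorm q a := by
  obtain ⟨ε, hε, hε'⟩ := exists_pos_forall_le (fun i => logNorm q (α i) / (α i).re)
    fun i => div_pos (by have := h i; simp only [StrictlyUnder] at this; simp only [logNorm]; linarith)
      (hα i)
  refine ⟨ε, hε, fun a ha => genSemigroup_induction (fun i => ?_) (by simp [logNorm_zero])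
    (fun a b ha hb => ?_) ha⟩
  · have := hε' i
    rw [le_div_iff₀ (hα i)] at this
    linarith
  · rw [logNorm_add, Complex.add_re]; linarith

theorem norm_chi_le_one {s : ℕ} {q : ℂ} {α : Fin s → ℂ}
    (h : ∀ i, StrictlyAbove q (α i) ∨ OnLine q (α i)) {g : ℝ ×ₗ ℝ}
    (hg : g ∈ expoSemigroup α) : ‖chi q g‖ ≤ 1 := by
  rw [chi, norm_qPow, Real.exp_le_one_iff]
  refine genSemigroup_induction (fun i => ?_) (logNorm_zero q).le (fun a b ha hb => ?_)
    (mem_expoSemigroup.1 hg)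
  · simp only [logNorm]
    rcases h i with h | h
    · simp only [StrictlyAbove] at h; linarith
    · simp only [OnLine] at h; linarith
  · rw [logNorm_add]; linarith

theorem one_le_norm_chi {s : ℕ} {q : ℂ} {α : Fin s → ℂ}
    (h : ∀ i, StrictlyUnder q (α i) ∨ OnLine q (α i)) {g : ℝ ×ₗ ℝ}
    (hg : g ∈ expoSemigroup α) : 1 ≤ ‖chi q g‖ := by
  rw [chi, norm_qPow, Real.one_le_exp_iff]
  refine genSemigroup_induction (fun i => ?_) (logNorm_zero q).ge (fun a b ha hb => ?_)
    (mem_expoSemigroup.1 hg)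
  · simp only [logNorm]
    rcases h i with h | h
    · simp only [StrictlyUnder] at h; linarith
    · simp only [OnLine] at h; linarith
  · rw [logNorm_add]; linarith

/-! ### Diophantine inequalities -/

/-- If `w` stays away from all `2 π i k`, then `exp w` stays away from `1`. -/
theorem le_norm_exp_sub_one {w : ℂ} {d : ℝ} (hd1 : d ≤ 1)
    (h : ∀ k : ℤ, d ≤ ‖w - 2 * (Real.pi : ℂ) * (k : ℂ) * Complex.I‖) :
    d / 2 ≤ ‖Complex.exp w - 1‖ := by
  by_contra! hlt
  have hle : ‖Complex.exp w - 1‖ ≤ 1 / 2 := by linarith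
  have h1 := Complex.norm_log_one_add_half_le_self hle
  rw [add_sub_cancel] at h1
  obtain ⟨k, hk⟩ := Complex.exp_eq_exp_iff_exists_int.1 (Complex.exp_log (Complex.exp_ne_zero w))
  have h2 := h (-k)
  rw [hk] at h1
  have h3 : w - 2 * (Real.pi : ℂ) * ((-k : ℤ) : ℂ) * Complex.I =
      w + k * (2 * Real.pi * Complex.I) := by push_cast; ring
  rw [h3] at h2
  linarith [norm_nonneg (Complex.exp w - 1)]

theorem exists_le_norm_sub_of_diophantine {s : ℕ} {q lam : ℂ} {α : Fin s → ℂ}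
    (hα : ∀ i, 0 < (α i).re) {a : ℂ} (ha : a ≠ 0) (h : Diophantine q lam α a) :
    ∃ c ν : ℝ, 0 < c ∧ 0 < ν ∧ ∀ g ∈ posPart (expoSemigroup α),
      c * reE g ^ (-ν) ≤ ‖qPow q lam * chi q g - a‖ := by
  obtain ⟨C, ν, hC, hν, h⟩ := h
  obtain ⟨δ, hδ, hgap⟩ := exists_gap_expoSemigroup hα
  have ha0 : 0 < ‖a‖ := norm_pos_iff.2 ha
  refine ⟨‖a‖ * (min C 1 * δ ^ ν / 2), ν, by positivity, hν, fun g hg => ?_⟩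
  obtain ⟨m, hm, hgm⟩ := exists_coeffs_of_mem_posPart hg
  set N : ℝ := ((∑ i, m i : ℕ) : ℝ) with hN
  have hN1 : 1 ≤ N := by rw [hN]; exact_mod_cast one_le_sum_of_ne_zero hm
  have hN0 : 0 < N := by linarith
  have hre0 : 0 < reE g := hδ.trans_le (le_reE_of_mem_posPart hδ hgap g hg)
  have hNg : δ * N ≤ reE g := by rw [← re_expoVal, hgm]; exact hgap m
  have hpow : δ ^ ν * reE g ^ (-ν) ≤ N ^ (-ν) := by
    rw [Real.rpow_neg hre0.le, Real.rpow_neg hN0.le, ← div_eq_mul_inv,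
      div_le_iff₀ (by positivity), ← div_eq_inv_mul, le_div_iff₀ (by positivity),
      ← Real.mul_rpow hδ.le hN0.le]
    gcongr
  set w := (lam + expoVal g) * lnQ q - Complex.log a with hw
  have hexp : qPow q lam * chi q g - a = a * (Complex.exp w - 1) := by
    rw [hw, Complex.exp_sub, Complex.exp_log ha, chi, ← qPow_add, qPow]
    field_simp
  have hd := le_norm_exp_sub_one (w := w) (d := min C 1 * N ^ (-ν))
    (mul_le_one₀ (min_le_right _ _) (by positivity)
      (Real.rpow_le_one_of_one_le_of_nonpos hN1 (by linarith))) fun k => by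
        have := (h m hm k).le
        rw [← hgm] at this
        refine le_trans ?_ this
        gcongr
        exact min_le_left _ _
  rw [hexp, norm_mul]
  calc ‖a‖ * (min C 1 * δ ^ ν / 2) * reE g ^ (-ν)
      = ‖a‖ * (min C 1 * (δ ^ ν * reE g ^ (-ν)) / 2) := by ring
    _ ≤ ‖a‖ * (min C 1 * N ^ (-ν) / 2) := by gcongr
    _ ≤ _ := by gcongr

/-! ### Divisors away from the unit circle -/

theorem exists_le_norm_eval_near_zero {L : Polynomial ℂ} (hL : L.eval 0 ≠ 0) :
    ∃ η c : ℝ, 0 < η ∧ 0 < c ∧ ∀ ξ : ℂ, ‖ξ‖ < η → c ≤ ‖L.eval ξ‖ := by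
  have h0 : 0 < ‖L.eval 0‖ := norm_pos_iff.2 hL
  have hc : ∀ᶠ ξ in nhds (0 : ℂ), ‖L.eval 0‖ / 2 < ‖L.eval ξ‖ :=
    continuousAt_const.eventually_lt L.continuous.norm.continuousAt (by linarith)
  obtain ⟨η, hη, h⟩ := Metric.eventually_nhds_iff.1 hc
  exact ⟨η, _, hη, half_pos h0, fun ξ hξ => (h (by simpa using hξ)).le⟩

theorem exists_pow_le_norm_eval {L : Polynomial ℂ} (hL : L ≠ 0) :
    ∃ R c : ℝ, 0 < c ∧ ∀ ξ : ℂ, R < ‖ξ‖ → c * ‖ξ‖ ^ L.natDegree ≤ ‖L.eval ξ‖ := by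
  have h0 : L.reverse.eval 0 ≠ 0 := by
    rw [← Polynomial.coeff_zero_eq_eval_zero, Polynomial.coeff_zero_reverse]
    exact Polynomial.leadingCoeff_ne_zero.2 hL
  obtain ⟨η, c, hη, hc, h⟩ := exists_le_norm_eval_near_zero h0
  refine ⟨η⁻¹, c, hc, fun ξ hξ => ?_⟩
  have hpos : 0 < ‖ξ‖ := (inv_pos.2 hη).trans hξ
  have hξ0 : ξ ≠ 0 := norm_pos_iff.1 hpos
  let _ := invertibleOfNonzero hξ0
  have h1 := Polynomial.eval₂_reverse_mul_pow (RingHom.id ℂ) ξ L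
  rw [Polynomial.eval₂_id, Polynomial.eval₂_id, invOf_eq_inv] at h1
  rw [← h1, norm_mul, norm_pow]
  gcongr
  exact h _ (by rw [norm_inv]; exact inv_lt_of_inv_lt₀ hη hξ)

/-! ### Convergence without small divisors -/

theorem exists_gap_of_isPWO {S : Set (ℝ ×ₗ ℝ)} (hS : S.IsPWO) {t : ℝ} (h : ∀ g ∈ S, t < reE g) :
    ∃ ε : ℝ, 0 < ε ∧ ∀ g ∈ S, t + ε ≤ reE g := by
  by_cases hne : S.Nonempty
  · refine ⟨reE (hS.isWF.min hne) - t, sub_pos.2 (h _ (hS.isWF.min_mem hne)), fun g hg => ?_⟩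
    rw [add_sub_cancel]
    exact reE_mono (hS.isWF.min_le hne hg)
  · exact ⟨1, one_pos, fun g hg => absurd ⟨g, hg⟩ hne⟩

theorem exists_lower_bound (x : FormalSeries) : ∃ M : ℝ, ∀ g, x.coeff g ≠ 0 → M ≤ reE g := by
  by_cases hne : x.support.Nonempty
  · exact ⟨reE (x.isPWO_support.isWF.min hne),
      fun g hg => reE_mono (x.isPWO_support.isWF.min_le hne hg)⟩
  · exact ⟨0, fun g hg => absurd ⟨g, hg⟩ hne⟩

/-- The submonoid of exponents that are `0` or have real part at least `δ`. -/
noncomputable def gapSubmonoid {δ : ℝ} (hδ : 0 < δ) : AddSubmonoid (ℝ ×ₗ ℝ) where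
  carrier := {g | g = 0 ∨ δ ≤ reE g}
  zero_mem' := Or.inl rfl
  add_mem' {a b} ha hb := by
    rcases ha with rfl | ha
    · rwa [zero_add]
    rcases hb with rfl | hb
    · rw [add_zero]; exact Or.inr ha
    · refine Or.inr ?_
      rw [map_add]; linarith

theorem mem_posPart_gapSubmonoid {δ : ℝ} (hδ : 0 < δ) {g : ℝ ×ₗ ℝ} :
    g ∈ posPart (gapSubmonoid hδ) ↔ δ ≤ reE g := by
  refine ⟨fun h => h.1.resolve_left h.2, fun h => ⟨Or.inr h, ?_⟩⟩
  rintro rfl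
  rw [map_zero] at h
  linarith

theorem suppIn_prod_pow {ι : Type*} [Fintype ι] {v : ι → FormalSeries} {T : ℝ}
    (hv : ∀ k, SuppIn {g | reE g = T} (v k)) (p : ι →₀ ℕ) :
    SuppIn {g | reE g = p.degree * T} (∏ k, v k ^ p k) := by
  induction hm : p.degree generalizing p with
  | zero =>
    obtain rfl : p = 0 := (Finsupp.degree_eq_zero_iff p).1 hm
    simp only [Finsupp.coe_zero, Pi.zero_apply, pow_zero, Finset.prod_const_one]
    exact suppIn_single (by simp) 1
  | succ m ih =>
    obtain ⟨k, d, rfl⟩ := exists_eq_single_add (d := p) (by rintro rfl; simp at hm)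
    have hd : d.degree = m := by
      simp only [map_add, Finsupp.degree_single] at hm; omega
    rw [prod_pow_single_add]
    refine suppIn_mul (hv k) (ih d hd) fun g hg g' hg' => ?_
    simp only [Set.mem_ofPred_eq] at hg hg' ⊢
    rw [map_add, hg, hg']; push_cast; ring

theorem leadPoly_ne_zero {q : ℂ} {F : MvPolynomial (Option (Fin (n + 1))) ℂ}
    {φ : GenPowerSeries} {κ : ℂ} (hκ : HasLeadingExponent q F φ κ) : leadPoly q F φ κ ≠ 0 := by
  obtain ⟨k, hk⟩ := hκ.2.2
  intro h
  have h1 : (leadPoly q F φ κ).coeff k = (derivSeries q F φ k).coeff (expo κ) := by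
    simp only [leadPoly, Polynomial.finsetSum_coeff, Polynomial.coeff_C_mul,
      Polynomial.coeff_X_pow]
    rw [Finset.sum_eq_single k]
    · simp
    · intro l _ hl
      rw [if_neg fun h' => hl (Fin.ext h'.symm), mul_zero]
    · simp
  rw [h, Polynomial.coeff_zero] at h1
  exact hk h1.symm

/-- After the substitution `y = φ + z ^ T v` with `T` large, the equation has the leading part
`z ^ {T + κ} L(q ^ T σ) v`: the coefficients of order at least two have exponents bounded below,
and gain at least `z ^ {2 T}`. -/
theorem exists_suppIn_reducedPoly {q : ℂ} {F : MvPolynomial (Option (Fin (n + 1))) ℂ}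
    {φ : GenPowerSeries} (hsol : substSeries q F φ.series = 0) {κ : ℂ}
    (hκ : HasLeadingExponent q F φ κ) :
    ∃ (δ : ℝ) (hδ : 0 < δ) (T : ℝ), ∀ p, SuppIn (gapSubmonoid hδ : Set (ℝ ×ₗ ℝ))
      (coeff p (reducedPoly q F T (T + κ) φ.series)) := by
  have hgap : ∀ k : Fin (n + 1), ∃ ε : ℝ, 0 < ε ∧ ∀ g, (derivSeries q F φ k).coeff g ≠ 0 →
      g = expo κ ∨ κ.re + ε ≤ reE g := by
    intro k
    obtain ⟨ε, hε, h⟩ := exists_gap_of_isPWO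
      (S := {g | (derivSeries q F φ k).coeff g ≠ 0 ∧ κ.re < reE g}) (t := κ.re)
      ((derivSeries q F φ k).isPWO_support.mono fun g hg => hg.1) fun g hg => hg.2
    refine ⟨ε, hε, fun g hg => ?_⟩
    rcases hκ.2.1 k (expoVal g) (by rwa [expo_expoVal]) with h1 | h1
    · exact Or.inl (by rw [← h1, expo_expoVal])
    · exact Or.inr (h g ⟨hg, h1⟩)
  choose ε hε hgap using hgap
  obtain ⟨δ, hδ, hδε⟩ := exists_pos_forall_le ε hε
  set P₁ := shiftPoly q F φ.series 1 with hP₁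
  choose M hM using fun p => exists_lower_bound (coeff p P₁)
  obtain ⟨M₀, hM₀⟩ := (P₁.support.image M).bddBelow
  have hM' : ∀ p g, (coeff p P₁).coeff g ≠ 0 → M₀ ≤ reE g := by
    intro p g hg
    have hp : p ∈ P₁.support := by
      rw [MvPolynomial.mem_support_iff]
      rintro h
      simp [h] at hg
    exact (hM₀ (Finset.mem_coe.2 (Finset.mem_image_of_mem M hp))).trans (hM p g hg)
  set T := max 0 (κ.re + δ - M₀) with hT
  have hT0 : 0 ≤ T := le_max_left _ _
  have hT1 : κ.re + δ - M₀ ≤ T := le_max_right _ _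
  refine ⟨δ, hδ, T, fun p g hg => ?_⟩
  rw [coeff_reducedPoly] at hg
  have hre : reE (g + expo (T + κ)) = reE g + T + κ.re := by
    rw [map_add, reE_expo, Complex.add_re, Complex.ofReal_re]; ring
  rcases Nat.lt_or_ge p.degree 2 with hp | hp
  · by_cases hp0 : p = 0
    · rw [hp0, coeff_zero_shiftPoly, hsol] at hg
      exact absurd rfl hg
    obtain ⟨k, d, rfl⟩ := exists_eq_single_add hp0
    have hd : d = 0 := by
      rw [← Finsupp.degree_eq_zero_iff]
      rw [map_add, Finsupp.degree_single] at hp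
      omega
    rw [hd, add_zero, coeff_single_shiftPoly, mono, dilPow_single, HahnSeries.coeff_single_mul,
      expo_add, add_left_comm, add_sub_cancel_left] at hg
    rcases hgap k _ (right_ne_zero_of_mul hg) with h | h
    · exact Or.inl (by simpa using h)
    · rw [map_add, reE_expo] at h
      exact Or.inr (by linarith [hδε k])
  · rw [coeff_shiftPoly] at hg
    have hs := suppIn_mul (S := {g | M₀ ≤ reE g}) (T := {g | reE g = p.degree * T})
      (U := {g | M₀ + 2 * T ≤ reE g}) (hM' p)
      (suppIn_prod_pow (v := fun k : Fin (n + 1) => dilPow q k (mono (T : ℂ) 1))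
        (fun k => suppIn_dilPow q k (suppIn_single (by simp [reE_expo]) 1)) p) (by
        intro a ha b hb
        simp only [Set.mem_ofPred_eq] at ha hb ⊢
        rw [map_add, hb]
        have : (2 : ℝ) ≤ p.degree := by exact_mod_cast hp
        nlinarith) _ hg
    simp only [Set.mem_ofPred_eq, hre] at hs
    exact Or.inr (by linarith)

/-- If the divisors `L(q ^ {lam_j})` are bounded below relative to the growth of `q ^ {n lam_j}`, the
series converges. -/
theorem exists_summable_of_divisor_bound {q : ℂ} {F : MvPolynomial (Option (Fin (n + 1))) ℂ}
    {φ : GenPowerSeries} (hsol : substSeries q F φ.series = 0) {κ : ℂ}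
    (hκ : HasLeadingExponent q F φ κ) {C : ℝ} (hC : 0 ≤ C)
    (hdiv : ∀ᶠ j in atTop, φ.c j ≠ 0 → max 1 ‖qPow q (φ.lam j)‖ ^ n ≤
      C * ‖(leadPoly q F φ κ).eval (qPow q (φ.lam j))‖) :
    ∃ ρ : ℝ, 0 < ρ ∧ Summable fun j => ‖φ.c j‖ * ρ ^ (φ.lam j).re := by
  obtain ⟨δ, hδ, T, hT⟩ := exists_suppIn_reducedPoly hsol hκ
  obtain ⟨J, hJ⟩ := eventually_atTop.1 (hdiv.and (φ.re_tendsto.eventually_ge_atTop (T + δ)))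
  set u := tail φ J T with hu
  have hG : ∀ g ∈ posPart (gapSubmonoid hδ), δ ≤ reE g :=
    fun g hg => (mem_posPart_gapSubmonoid hδ).1 hg
  have husupp : SuppIn (posPart (gapSubmonoid hδ)) u := by
    intro g hg
    obtain ⟨j, hj, -, rfl⟩ := exists_of_coeff_tail_ne_zero φ J T hg
    rw [mem_posPart_gapSubmonoid, reE_expo, Complex.sub_re, Complex.ofReal_re]
    linarith [(hJ j hj.le).2]
  have hsum := initial_add_tail φ J T
  rw [← hu] at hsum
  have hx : φ.series + mono (T : ℂ) 1 * -u = φ.initial J := by rw [← hsum]; ring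
  set c₀ : ℝ := max 1 ‖qPow q (-(T : ℂ))‖ with hc₀
  have hc₀1 : 0 < c₀ := lt_max_of_lt_left one_pos
  obtain ⟨ρ, hρ, h⟩ := exists_wnorm_lt_top_of_controlled q F (μ := T) (κ := κ)
    (initial_mem_finiteSubalgebra φ J) (by rw [hsum]; exact hsol) hδ hG husupp (fun p => by
      rw [← hx, ← bind₁_reducedPoly]
      exact (bind₁_translate (fun g hg => hδ.trans_le (hG g hg)) hT
        (fun k => suppIn_dilPow q k (suppIn_neg husupp)) p).1)
    (L := leadPoly q F φ κ) (by rw [hsum]; rfl)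
    (D := fun _ => c₀ ^ n * C) (Controlled.const (by positivity) fun _ _ => le_rfl) (by
      intro g hg
      obtain ⟨j, hj, hcj, rfl⟩ := exists_of_coeff_tail_ne_zero φ J T hg
      have h1 : qPow q T * chi q (expo (φ.lam j - T)) = qPow q (φ.lam j) := by
        rw [chi_expo, ← qPow_add, add_sub_cancel]
      rw [h1]
      have h2 : max 1 ‖chi q (expo (φ.lam j - T))‖ ≤ c₀ * max 1 ‖qPow q (φ.lam j)‖ := by
        rw [chi_expo, sub_eq_neg_add, qPow_add, norm_mul]
        refine max_le (one_le_mul_of_one_le_of_one_le (le_max_left _ _) (le_max_left _ _)) ?_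
        gcongr
        · exact le_max_right _ _
        · exact le_max_right _ _
      calc _ ≤ (c₀ * max 1 ‖qPow q (φ.lam j)‖) ^ n := by gcongr
        _ = c₀ ^ n * max 1 ‖qPow q (φ.lam j)‖ ^ n := mul_pow _ _ _
        _ ≤ c₀ ^ n * (C * ‖(leadPoly q F φ κ).eval (qPow q (φ.lam j))‖) := by
            gcongr; exact (hJ j hj.le).1 hcj
        _ = _ := by ring)
  exact ⟨ρ, hρ, summable_of_wnorm_tail φ J T hρ h⟩

/-! ### Convergence with small divisors -/

/-- The cases with small divisors: if every root of `L` is harmless and `q ^ {lam_{j₀}}` satisfies the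
Diophantine inequality, the series converges. -/
theorem exists_summable_of_rootCondition {s : ℕ} {q : ℂ}
    {F : MvPolynomial (Option (Fin (n + 1))) ℂ} {φ : GenPowerSeries}
    (hsol : substSeries q F φ.series = 0) {κ : ℂ} (hκ : HasLeadingExponent q F φ κ) {j₀ : ℕ}
    {α : Fin s → ℂ} (hα : ∀ i, 0 < (α i).re)
    (hΓ : ∀ j, j₀ < j → φ.c j ≠ 0 → φ.lam j - φ.lam j₀ ∈ genSemigroup α)
    (hred : ReducedExponentsIn q F φ κ j₀ α)
    (hW : ∀ g ∈ posPart (expoSemigroup α),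
      max 1 ‖chi q g‖ ^ n ≤ max 1 ‖chi q g‖ ^ (leadPoly q F φ κ).roots.card)
    (hroot : ∀ a ∈ (leadPoly q F φ κ).roots,
      RootCondition q (expoSemigroup α) (qPow q (φ.lam j₀)) a)
    (hdio : Diophantine q (φ.lam j₀) α (qPow q (φ.lam j₀))) :
    ∃ ρ : ℝ, 0 < ρ ∧ Summable fun j => ‖φ.c j‖ * ρ ^ (φ.lam j).re := by
  set μ := φ.lam j₀ with hμ
  obtain ⟨δ, hδ, hgap⟩ := exists_gap_expoSemigroup hα
  have hG := le_reE_of_mem_posPart hδ hgap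
  have hm : qPow q μ ≠ 0 := qPow_ne_zero q μ
  obtain ⟨c, ν, hc, hν, h1⟩ := exists_le_norm_sub_of_diophantine hα hm hdio
  have h1' : ∀ g ∈ posPart (expoSemigroup α),
      c / ‖qPow q μ‖ * reE g ^ (-ν) ≤ ‖chi q g - 1‖ := by
    intro g hg
    have h2 := h1 g hg
    rw [← mul_sub_one, norm_mul] at h2
    rw [div_mul_eq_mul_div, div_le_iff₀ (norm_pos_iff.2 hm)]
    linarith
  obtain ⟨D, hD, hDL⟩ := controlled_divisor hm (fun g hg => hδ.trans_le (hG g hg))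
    (leadPoly_ne_zero hκ) hW hroot (div_pos hc (norm_pos_iff.2 hm)) hν h1'
  set u := tail φ j₀ μ with hu
  have husupp : SuppIn (posPart (expoSemigroup α)) u := by
    intro g hg
    obtain ⟨j, hj, hcj, rfl⟩ := exists_of_coeff_tail_ne_zero φ j₀ μ hg
    refine ⟨hΓ j hj hcj, fun h => ?_⟩
    have h2 : φ.lam j - μ = 0 := expo_injective (h.trans expo_zero.symm)
    exact hj.ne' (φ.lam_injective (sub_eq_zero.1 h2))
  have hsum := initial_add_tail φ j₀ μ
  rw [← hu] at hsum
  obtain ⟨ρ, hρ, h⟩ := exists_wnorm_lt_top_of_controlled q F (μ := μ) (κ := κ)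
    (initial_mem_finiteSubalgebra φ j₀) (by rw [hsum]; exact hsol) hδ hG husupp (fun p g hg => by
      rw [coeff_reducedPoly, hμ, ← shiftedPoly_eq, ← expo_expoVal (g + _)] at hg
      have h2 := hred p _ hg
      rwa [expoVal_add, expoVal_expo, add_sub_cancel_right] at h2)
    (L := leadPoly q F φ κ) (by rw [hsum]; rfl) hD fun g hg => hDL g (husupp g hg)
  exact ⟨ρ, hρ, summable_of_wnorm_tail φ j₀ μ hρ h⟩

theorem converges_of_exists_summable {s : ℕ} {φ : GenPowerSeries} {j₀ : ℕ} {α : Fin s → ℂ}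
    (hα : ∀ i, 0 < (α i).re)
    (hΓ : ∀ j, j₀ < j → φ.c j ≠ 0 → φ.lam j - φ.lam j₀ ∈ genSemigroup α)
    (h : ∃ ρ : ℝ, 0 < ρ ∧ Summable fun j => ‖φ.c j‖ * ρ ^ (φ.lam j).re) : φ.Converges := by
  obtain ⟨ρ, hρ, h⟩ := h
  obtain ⟨K, hK⟩ := exists_abs_im_le hα
  refine converges_of_summable φ hρ h (K := K) (K' := |(φ.lam j₀).im| - K * (φ.lam j₀).re)
    (J := j₀ + 1) fun j hj hcj => ?_
  have h1 := hK _ (hΓ j hj hcj)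
  rw [Complex.sub_im, Complex.sub_re] at h1
  have h2 : |(φ.lam j).im| ≤ |(φ.lam j).im - (φ.lam j₀).im| + |(φ.lam j₀).im| := by
    simpa using abs_add_le ((φ.lam j).im - (φ.lam j₀).im) (φ.lam j₀).im
  linarith

end QDiff

open QDiff in
theorem theorem1 {n s : ℕ} (q : ℂ) (hq0 : q ≠ 0) (hq1 : q ≠ 1)
    (F : MvPolynomial (Option (Fin (n + 1))) ℂ) (φ : GenPowerSeries)
    (hsol : substSeries q F φ.series = 0)
    (κ : ℂ) (hκ : HasLeadingExponent q F φ κ)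
    (j₀ : ℕ) (α : Fin s → ℂ) (hα : ∀ i, 0 < (α i).re)
    (hΓ : ∀ j, j₀ < j → φ.c j ≠ 0 → φ.lam j - φ.lam j₀ ∈ genSemigroup α) :
    -- (a)
    ((leadPoly q F φ κ).eval 0 ≠ 0 → (∀ i, StrictlyAbove q (α i)) → φ.Converges) ∧
    -- (b)
    ((leadPoly q F φ κ).degree = n → (∀ i, StrictlyUnder q (α i)) → φ.Converges) ∧
    -- (c)
    (ReducedExponentsIn q F φ κ j₀ α → (∀ i, OnLine q (α i)) →
      (∀ a : ℂ, ((Polynomial.X - Polynomial.C (qPow q (φ.lam j₀))) * leadPoly q F φ κ).IsRoot a →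
        ‖a‖ = ‖qPow q (φ.lam j₀)‖ → Diophantine q (φ.lam j₀) α a) →
      φ.Converges) ∧
    -- (d)
    (ReducedExponentsIn q F φ κ j₀ α → (leadPoly q F φ κ).eval 0 ≠ 0 →
      (∀ i, StrictlyAbove q (α i) ∨ OnLine q (α i)) →
      (∀ a : ℂ, ((Polynomial.X - Polynomial.C (qPow q (φ.lam j₀))) * leadPoly q F φ κ).IsRoot a →
        ‖a‖ ≤ ‖qPow q (φ.lam j₀)‖ → Diophantine q (φ.lam j₀) α a) →
      φ.Converges) ∧
    -- (e)
    (ReducedExponentsIn q F φ κ j₀ α → (leadPoly q F φ κ).degree = n →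
      (∀ i, StrictlyUnder q (α i) ∨ OnLine q (α i)) →
      (∀ a : ℂ, ((Polynomial.X - Polynomial.C (qPow q (φ.lam j₀))) * leadPoly q F φ κ).IsRoot a →
        ‖qPow q (φ.lam j₀)‖ ≤ ‖a‖ → Diophantine q (φ.lam j₀) α a) →
      φ.Converges) := by
  have hL := leadPoly_ne_zero hκ
  set L := leadPoly q F φ κ with hLdef
  set m := qPow q (φ.lam j₀) with hm
  have hm0 : m ≠ 0 := qPow_ne_zero _ _
  have hroot : ∀ a ∈ L.roots, ((Polynomial.X - Polynomial.C m) * L).IsRoot a := by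
    intro a ha
    rw [Polynomial.IsRoot, Polynomial.eval_mul, (Polynomial.mem_roots hL).1 ha, mul_zero]
  have hrootm : ((Polynomial.X - Polynomial.C m) * L).IsRoot m := by simp
  have hzero : L.eval 0 ≠ 0 → ∀ a ∈ L.roots, a ≠ 0 := by
    rintro h a ha rfl
    exact h ((Polynomial.mem_roots hL).1 ha)
  -- the exponents `lam_j`, `j > j₀`, in terms of the semigroup
  have hlam : ∀ j, ‖qPow q (φ.lam j)‖ = ‖m‖ * Real.exp (logNorm q (φ.lam j - φ.lam j₀)) := by
    intro j
    rw [hm, norm_qPow, norm_qPow, ← Real.exp_add, ← logNorm_add, add_sub_cancel]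
  have hre : Tendsto (fun j => (φ.lam j - φ.lam j₀).re) atTop atTop := by
    simp only [Complex.sub_re]
    exact tendsto_atTop_add_const_right _ _ φ.re_tendsto
  refine ⟨fun h0 hab => ?_, fun hdeg hun => ?_, fun hred hon hdio => ?_,
    fun hred h0 hab hdio => ?_, fun hred hdeg hun hdio => ?_⟩ <;>
    refine converges_of_exists_summable hα hΓ ?_
  · obtain ⟨ε, hε, hle⟩ := exists_logNorm_le hα hab
    obtain ⟨η, c, hη, hc, hbd⟩ := exists_le_norm_eval_near_zero h0
    have hlim : Tendsto (fun j => ‖m‖ * Real.exp (-(ε * (φ.lam j - φ.lam j₀).re))) atTop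
        (nhds (‖m‖ * 0)) :=
      (Real.tendsto_exp_neg_atTop_nhds_zero.comp (hre.const_mul_atTop hε)).const_mul _
    rw [mul_zero] at hlim
    refine exists_summable_of_divisor_bound hsol hκ (C := c⁻¹) (by positivity) ?_
    filter_upwards [hlim.eventually_lt_const hη, hlim.eventually_lt_const one_pos,
      eventually_gt_atTop j₀] with j h1 h2 h3 hcj
    have h4 : ‖qPow q (φ.lam j)‖ ≤ ‖m‖ * Real.exp (-(ε * (φ.lam j - φ.lam j₀).re)) := by
      rw [hlam j]
      gcongr
      exact hle _ (hΓ j h3 hcj)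
    rw [max_eq_left (h4.trans h2.le), one_pow, ← div_eq_inv_mul, one_le_div hc]
    exact hbd _ (h4.trans_lt h1)
  · obtain ⟨ε, hε, hle⟩ := exists_le_logNorm hα hun
    obtain ⟨R, c, hc, hbd⟩ := exists_pow_le_norm_eval hL
    have hlim : Tendsto (fun j => ‖m‖ * Real.exp (ε * (φ.lam j - φ.lam j₀).re)) atTop atTop :=
      (Real.tendsto_exp_atTop.comp (hre.const_mul_atTop hε)).const_mul_atTop (norm_pos_iff.2 hm0)
    refine exists_summable_of_divisor_bound hsol hκ (C := c⁻¹) (by positivity) ?_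
    filter_upwards [hlim.eventually_gt_atTop R, hlim.eventually_ge_atTop 1,
      eventually_gt_atTop j₀] with j h1 h2 h3 hcj
    have h4 : ‖m‖ * Real.exp (ε * (φ.lam j - φ.lam j₀).re) ≤ ‖qPow q (φ.lam j)‖ := by
      rw [hlam j]
      gcongr
      exact hle _ (hΓ j h3 hcj)
    have h5 := hbd _ (h1.trans_le h4)
    rw [Polynomial.natDegree_eq_of_degree_eq_some hdeg] at h5
    rw [max_eq_right (h2.trans h4), ← div_eq_inv_mul, le_div_iff₀ hc]
    linarith
  · have hχ : ∀ g ∈ posPart (expoSemigroup α), ‖chi q g‖ = 1 := fun g hg =>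
      le_antisymm (norm_chi_le_one (fun i => Or.inr (hon i)) hg.1)
        (one_le_norm_chi (fun i => Or.inr (hon i)) hg.1)
    refine exists_summable_of_rootCondition hsol hκ hα hΓ hred (fun g hg => by simp [hχ g hg])
      (fun a ha => ?_) (hdio m hrootm rfl)
    by_cases hnorm : ‖a‖ = ‖m‖
    · have ha0 : a ≠ 0 := norm_pos_iff.1 (hnorm ▸ norm_pos_iff.2 hm0)
      exact Or.inl ⟨ha0, exists_le_norm_sub_of_diophantine hα ha0 (hdio a (hroot a ha) hnorm)⟩
    · refine Or.inr ⟨|‖m‖ - ‖a‖|, abs_pos.2 (sub_ne_zero.2 (Ne.symm hnorm)), fun g hg => ?_⟩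
      have := abs_norm_sub_norm_le (m * chi q g) a
      rw [norm_mul, hχ g hg, mul_one] at this
      rwa [hχ g hg, max_self, mul_one]
  · have hχ : ∀ g ∈ posPart (expoSemigroup α), ‖chi q g‖ ≤ 1 := fun g hg =>
      norm_chi_le_one hab hg.1
    refine exists_summable_of_rootCondition hsol hκ hα hΓ hred
      (fun g hg => by simp [max_eq_left (hχ g hg)]) (fun a ha => ?_) (hdio m hrootm le_rfl)
    by_cases hnorm : ‖a‖ ≤ ‖m‖
    · have ha0 : a ≠ 0 := hzero h0 a ha
      exact Or.inl ⟨ha0, exists_le_norm_sub_of_diophantine hα ha0 (hdio a (hroot a ha) hnorm)⟩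
    · refine Or.inr ⟨‖a‖ - ‖m‖, sub_pos.2 (not_le.1 hnorm), fun g hg => ?_⟩
      have h1 := norm_sub_norm_le a (m * chi q g)
      rw [norm_mul, norm_sub_rev] at h1
      have h2 : ‖m‖ * ‖chi q g‖ ≤ ‖m‖ := mul_le_of_le_one_right (norm_nonneg _) (hχ g hg)
      rw [max_eq_left (hχ g hg), mul_one]
      linarith
  · have hχ : ∀ g ∈ posPart (expoSemigroup α), 1 ≤ ‖chi q g‖ := fun g hg =>
      one_le_norm_chi hun hg.1
    have hcard : L.roots.card = n := by
      rw [IsAlgClosed.card_roots_eq_natDegree, Polynomial.natDegree_eq_of_degree_eq_some hdeg]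
    refine exists_summable_of_rootCondition hsol hκ hα hΓ hred
      (fun g hg => by rw [hcard]) (fun a ha => ?_) (hdio m hrootm le_rfl)
    by_cases hnorm : ‖m‖ ≤ ‖a‖
    · have ha0 : a ≠ 0 := norm_pos_iff.1 ((norm_pos_iff.2 hm0).trans_le hnorm)
      exact Or.inl ⟨ha0, exists_le_norm_sub_of_diophantine hα ha0 (hdio a (hroot a ha) hnorm)⟩
    · refine Or.inr ⟨‖m‖ - ‖a‖, sub_pos.2 (not_le.1 hnorm), fun g hg => ?_⟩
      have h1 := norm_sub_norm_le (m * chi q g) a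
      rw [norm_mul] at h1
      rw [max_eq_right (hχ g hg)]
      nlinarith [mul_le_mul_of_nonneg_left (hχ g hg) (norm_nonneg a)]
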